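/- Let $\mathbf N=\{1,2,3,\dots\}$. For sets $X=\{x_1<\dots<x_m\}$ and $Y=\{y_1<\dots<y_m\}$ of natural numbers write $X\preceq Y$ if $x_i\le y_i$ for every $i$. A *set family of shape* $(m^n)$ is a collection of $n$ distinct $m$-subsets of $\mathbf N$; it is *closed* if $Y\in\mathcal P$ and $X\prec Y$ imply $X\in\mathcal P$. For a partition $\lambda$ of $mn$ with conjugate $\lambda'$ (where $\lambda'_i=0$ if $i$ exceeds the largest part of $\lambda$), $\mathcal P$ has *type* $\lambda$ if, for each $i\in\mathbf N$, exactly $\lambda'_i$ sets of $\mathcal P$ contain $i$. Let $A(\lambda)$ be the set of the $mn$ symbols $i_j$ with $i\ge 1$ and $1\le j\le\lambda'_i$, and identify $S_{mn}$ with the symmetric group on $A(\lambda)$. A $\lambda$-tableau $t$ is a bijection from the boxes of the Young diagram of $\lambda$ to $A(\lambda)$; its tabloid $\mathbf t$ is obtained by disregarding the order within rows. Let $M^\lambda$ be the permutation $\mathbf Z S_{mn}$-module on the $\lambda$-tabloids. For a tableau $t$ let $C(t)\le S_{mn}$ be the group of permutations that fix the columns of $t$ setwise, put $b_t=\sum_{\tau\in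 C(t)}\operatorname{sgn}(\tau)\,\tau\in\mathbf Z S_{mn}$ and $e_t=\mathbf t\,b_t\in M^\lambda$, and let the Specht module $S^\lambda$ be the submodule of $M^\lambda$ spanned by all $e_t$. Let $t_\lambda$ be the tableau whose $i$-th column reads $i_1,i_2,\dots,i_{\lambda'_i}$ from top to bottom. The Foulkes module $H^{(m^n)}$ is the permutation $\mathbf Z S_{mn}$-module on the set partitions of $A(\lambda)$ into $n$ sets each of size $m$. For a set family $\mathcal P$ of shape $(m^n)$ and type $\lambda$, order its members lexicographically as $X_1<\dots<X_n$. The *indexed set partition $u$ associated to* $\mathcal P$ is the set partition of $A(\lambda)$ into $n$ sets of size $m$ obtained by appending an index to each element of $X_1,\dots,X_n$ in turn, an element $i\in X_r$ receiving the smallest positive index not already appended to an occurrence of $i$ in $X_1,\dots,X_{r-1}$. **Theorem 1.1.** Let $m$ be odd, let $n\in\mathbf N$, and let $\mathcal P$ be a closed set family of shape $(m^n)$ and type $\lambda$, with associated indexed set partition $u$. Then there is a unique homomorphism of $\mathbf Z S_{mn}$-modules $f_{\mathcal P}:S^\lambda\to H^{(m^n)}$ with $e_{t_\lambda}f_{\mathcal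 P}=u\,b_{t_\lambda}$, and $f_{\mathcal P}$ is injective. -/

import Mathlib

open scoped Pointwise MonoidAlgebra

namespace Foulkes

/-! ### Set families (the natural numbers of the set families start at 1, hence `ℕ+`) -/

/-- `Majorizes X Y` is `X ≼ Y`: the sets have the same size and, with both written in increasing
order, `x_k ≤ y_k` for each `k`. -/
def Majorizes (X Y : Finset ℕ+) : Prop :=
  List.Forall₂ (· ≤ ·) (X.sort (· ≤ ·)) (Y.sort (· ≤ ·))

/-- A set family of shape `(m^n)`: `n` distinct `m`-subsets of the natural numbers. -/
structure IsSetFamily (m n : ℕ) (P : Finset (Finset ℕ+)) : Prop where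
  card_family : P.card = n
  card_mem : ∀ X ∈ P, X.card = m

/-- A set family is closed if `Y ∈ P` and `X ≺ Y` imply `X ∈ P`. -/
def IsClosedFamily (P : Finset (Finset ℕ+)) : Prop :=
  ∀ Y ∈ P, ∀ X : Finset ℕ+, Majorizes X Y → X ≠ Y → X ∈ P

/-- The part `λ'_i` of the conjugate partition (`i ≥ 1`), i.e. the length of the `i`-th column of
the Young diagram; Mathlib numbers the columns from `0`. It is `0` if `i` exceeds the largest part
of `λ`. -/
def conjPart (lam : YoungDiagram) (i : ℕ+) : ℕ := lam.colLen i.natPred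

/-- The number of sets of `P` containing `i`. -/
def countContaining (P : Finset (Finset ℕ+)) (i : ℕ+) : ℕ := (P.filter (fun X => i ∈ X)).card

/-- `P` has type `λ`: exactly `λ'_i` sets of `P` contain `i`, for each `i` (for `i` larger than the
largest part of `λ` this says that no set contains `i`). -/
def HasType (P : Finset (Finset ℕ+)) (lam : YoungDiagram) : Prop :=
  ∀ i : ℕ+, countContaining P i = conjPart lam i

/-- Strict lexicographic order on finite sets of natural numbers written in increasing order. -/
def LexLT (X Y : Finset ℕ+) : Prop := X.sort (· ≤ ·) < Y.sort (· ≤ ·)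

instance (X Y : Finset ℕ+) : Decidable (LexLT X Y) :=
  inferInstanceAs (Decidable (X.sort (· ≤ ·) < Y.sort (· ≤ ·)))

/-- The index appended to `i ∈ X`. Going through the sets of `P` in lexicographic order, the
successive occurrences of `i` get the indices `1, 2, 3, …` (always the least one not yet used for
`i`), so that `i ∈ X` gets `1 +` the number of earlier sets of `P` containing `i`. -/
def indexOf (P : Finset (Finset ℕ+)) (X : Finset ℕ+) (i : ℕ+) : ℕ :=
  (P.filter (fun Y => LexLT Y X ∧ i ∈ Y)).card + 1

/-! ### Symbols, tableaux, tabloids -/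

/-- The set `A(λ)` of symbols `i_j`, `i ≥ 1` and `1 ≤ j ≤ λ'_i`; the symbol `i_j` is the pair
`(i, j)`. -/
def Symbol (lam : YoungDiagram) : Type := {s : ℕ+ × ℕ+ // (s.2 : ℕ) ≤ conjPart lam s.1}

/-- The number `i` of the symbol `i_j`. -/
def Symbol.number {lam : YoungDiagram} (s : Symbol lam) : ℕ+ := s.1.1

/-- The index `j` of the symbol `i_j`. -/
def Symbol.index {lam : YoungDiagram} (s : Symbol lam) : ℕ+ := s.1.2

/-- A `λ`-tableau: a bijection from the boxes of the Young diagram of `λ` (pairs (row, column),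
both counted from `0`) to the symbols. -/
abbrev Tableau (lam : YoungDiagram) : Type := {c : ℕ × ℕ // c ∈ lam} ≃ Symbol lam

/-- The tableau `t_λ`: its `i`-th column reads `i_1, i_2, …, i_{λ'_i}` from top to bottom. -/
def canonicalTableau (lam : YoungDiagram) : Tableau lam where
  toFun c := ⟨(Nat.succPNat c.1.2, Nat.succPNat c.1.1), by
    have h := YoungDiagram.mem_iff_lt_colLen.1 (show (c.1.1, c.1.2) ∈ lam from c.2)
    simpa [conjPart] using h⟩
  invFun s := ⟨(PNat.natPred s.1.2, PNat.natPred s.1.1), by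
    have h := s.2
    rw [conjPart, ← PNat.natPred_add_one s.1.2] at h
    exact YoungDiagram.mem_iff_lt_colLen.2 h⟩
  left_inv c := by simp
  right_inv s := by
    apply Subtype.ext
    simp

instance (lam : YoungDiagram) : DecidableEq (Symbol lam) :=
  inferInstanceAs (DecidableEq {s : ℕ+ × ℕ+ // (s.2 : ℕ) ≤ conjPart lam s.1})

instance (lam : YoungDiagram) : Fintype (Symbol lam) :=
  haveI : Fintype {c : ℕ × ℕ // c ∈ lam} :=
    inferInstanceAs (Fintype {c : ℕ × ℕ // c ∈ lam.cells})
  Fintype.ofEquiv _ (canonicalTableau lam)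

/-- The symmetric group on the symbols, identified with `S_r` for `λ` a partition of `r`. -/
abbrev SymbolPerm (lam : YoungDiagram) : Type := Equiv.Perm (Symbol lam)

/-- The row of `t` in which a symbol stands. -/
def rowOf {lam : YoungDiagram} (t : Tableau lam) (a : Symbol lam) : ℕ := (t.symm a).1.1

/-- The column of `t` in which a symbol stands. -/
def colOf {lam : YoungDiagram} (t : Tableau lam) (a : Symbol lam) : ℕ := (t.symm a).1.2

/-- Permutations of the symbols act on tableaux entrywise. -/
instance (lam : YoungDiagram) : MulAction (SymbolPerm lam) (Tableau lam) where
  smul σ t := t.trans σ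
  one_smul _ := rfl
  mul_smul _ _ _ := rfl

/-- Two tableaux are row equivalent if corresponding rows have the same entries. -/
instance rowSetoid (lam : YoungDiagram) : Setoid (Tableau lam) where
  r s t := ∀ a, rowOf s a = rowOf t a
  iseqv := ⟨fun _ _ => rfl, fun h a => (h a).symm, fun h k a => (h a).trans (k a)⟩

/-- `λ`-tabloids. -/
def Tabloid (lam : YoungDiagram) : Type := Quotient (rowSetoid lam)

/-- The tabloid of a tableau. -/
def Tableau.tabloid {lam : YoungDiagram} (t : Tableau lam) : Tabloid lam := Quotient.mk _ t

instance (lam : YoungDiagram) : MulAction (SymbolPerm lam) (Tabloid lam) where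
  smul σ := Quotient.map (fun t => σ • t) (fun _ _ h a => h (σ⁻¹ a))
  one_smul x := by
    induction x using Quotient.inductionOn
    rfl
  mul_smul _ _ x := by
    induction x using Quotient.inductionOn
    rfl

/-! ### Permutation modules and Specht modules -/

/-- The permutation module `ℤX` of a `G`-set `X`, as a module over the group ring `ℤ[G]`. -/
abbrev PermModule (G X : Type) [Group G] [MulAction G X] : Type :=
  (Representation.ofMulAction ℤ G X).asModule

/-- The element of the canonical permutation basis given by `x`. -/
noncomputable def basisVector (G : Type) {X : Type} [Group G] [MulAction G X] (x : X) :
    PermModule G X :=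
  (Representation.ofMulAction ℤ G X).asModuleEquiv.symm (MonoidAlgebra.single x 1)

/-- The Young permutation module `M^λ`. -/
abbrev YoungModule (lam : YoungDiagram) : Type := PermModule (SymbolPerm lam) (Tabloid lam)

/-- The group `C(t)` of permutations fixing setwise the columns of `t`. -/
def columnStabilizer {lam : YoungDiagram} (t : Tableau lam) : Subgroup (SymbolPerm lam) where
  carrier := {σ | ∀ a, colOf t (σ a) = colOf t a}
  one_mem' _ := rfl
  mul_mem' h k a := (h _).trans (k a)
  inv_mem' {σ} h a := by
    have := h (σ⁻¹ a)
    simpa using this.symm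

open Classical in
/-- `b_t = ∑_{τ ∈ C(t)} sgn(τ) τ`, an element of the group ring. -/
noncomputable def signedColumnSum {lam : YoungDiagram} (t : Tableau lam) : ℤ[SymbolPerm lam] :=
  ∑ τ : SymbolPerm lam with τ ∈ columnStabilizer t,
    (Equiv.Perm.sign τ : ℤ) • MonoidAlgebra.of ℤ (SymbolPerm lam) τ

/-- The polytabloid `e_t`. -/
noncomputable def polytabloid {lam : YoungDiagram} (t : Tableau lam) : YoungModule lam :=
  signedColumnSum t • basisVector (SymbolPerm lam) t.tabloid

/-- The Specht module `S^λ`: the submodule of `M^λ` spanned by the polytabloids. -/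
noncomputable def SpechtModule (lam : YoungDiagram) :
    Submodule ℤ[SymbolPerm lam] (YoungModule lam) :=
  Submodule.span ℤ[SymbolPerm lam] (Set.range polytabloid)

/-- The polytabloid `e_t` as an element of the Specht module. -/
noncomputable def spechtPolytabloid {lam : YoungDiagram} (t : Tableau lam) : SpechtModule lam :=
  ⟨polytabloid t, Submodule.subset_span ⟨t, rfl⟩⟩

/-! ### Foulkes modules -/

/-- Set partitions of `α` into `n` sets each of size `m`. -/
def UniformPartition (α : Type) [Fintype α] [DecidableEq α] (m n : ℕ) : Type :=
  {u : Finpartition (Finset.univ : Finset α) // u.parts.card = n ∧ ∀ B ∈ u.parts, B.card = m}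

section Action

variable {α : Type} [Fintype α] [DecidableEq α] {m n : ℕ}

/-- The set partition `{σ B : B ∈ u}`. -/
def permPartition (σ : Equiv.Perm α) (u : Finpartition (Finset.univ : Finset α)) :
    Finpartition (Finset.univ : Finset α) where
  parts := σ • u.parts
  supIndep := by
    rw [Finset.supIndep_iff_pairwiseDisjoint]
    intro B hB C hC hne
    obtain ⟨B', hB', rfl⟩ := Finset.mem_smul_finset.1 (Finset.mem_coe.1 hB)
    obtain ⟨C', hC', rfl⟩ := Finset.mem_smul_finset.1 (Finset.mem_coe.1 hC)
    have h : Disjoint B' C' := u.disjoint hB' hC' (fun h => hne (by rw [h]))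
    change Disjoint (σ • B') (σ • C')
    rw [Finset.disjoint_left] at h ⊢
    intro a ha hb
    rw [Finset.mem_smul_finset] at ha hb
    obtain ⟨x, hx, rfl⟩ := ha
    obtain ⟨y, hy, hxy⟩ := hb
    rw [smul_left_cancel σ hxy] at hy
    exact h hx hy
  sup_parts := by
    refine Finset.eq_univ_of_forall fun a => ?_
    obtain ⟨B, hB, ha⟩ := u.exists_mem (Finset.mem_univ (σ⁻¹ a))
    rw [Finset.mem_sup]
    refine ⟨σ • B, Finset.smul_mem_smul_finset hB, ?_⟩
    exact Finset.mem_smul_finset.2 ⟨_, ha, by simp⟩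
  bot_notMem := by
    intro h
    obtain ⟨B, hB, h0⟩ := Finset.mem_smul_finset.1 h
    rw [Finset.bot_eq_empty, Finset.smul_finset_eq_empty] at h0
    exact u.bot_notMem (by rwa [h0] at hB)

/-- A permutation `σ` takes a set partition `u` to `{σ B : B ∈ u}`. -/
instance : MulAction (Equiv.Perm α) (UniformPartition α m n) where
  smul σ u := ⟨permPartition σ u.1, by
    refine ⟨(Finset.card_smul_finset σ _).trans u.2.1, fun B hB => ?_⟩
    obtain ⟨C, hC, rfl⟩ := Finset.mem_smul_finset.1 hB
    exact (Finset.card_smul_finset σ _).trans (u.2.2 C hC)⟩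
  one_smul u := Subtype.ext (Finpartition.ext (one_smul _ _))
  mul_smul σ τ u := Subtype.ext (Finpartition.ext (mul_smul σ τ u.1.parts))

end Action

/-- The Foulkes module `H^{(m^n)}`, the symmetric group being that on a finite set `α`. -/
abbrev FoulkesModule (α : Type) [Fintype α] [DecidableEq α] (m n : ℕ) : Type :=
  PermModule (Equiv.Perm α) (UniformPartition α m n)

/-! ### The indexed set partition associated to a set family -/

/-- The set of symbols obtained from `X` by appending indices to its elements. -/
def indexedBlock (lam : YoungDiagram) (P : Finset (Finset ℕ+)) (X : Finset ℕ+) :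
    Finset (Symbol lam) :=
  Finset.univ.filter (fun s => s.number ∈ X ∧ (s.index : ℕ) = indexOf P X s.number)

/-- Within a set family, the sets containing `i` get different indices for `i`. -/
theorem indexOf_injOn (P : Finset (Finset ℕ+)) (i : ℕ+) :
    Set.InjOn (fun X => indexOf P X i) (P.filter (fun X => i ∈ X) : Finset (Finset ℕ+)) := by
  have key : ∀ X ∈ P, i ∈ X → ∀ Y, LexLT X Y → indexOf P X i < indexOf P Y i := by
    intro X hX hi Y hXY
    unfold indexOf
    refine Nat.succ_lt_succ (Finset.card_lt_card ?_)
    rw [Finset.ssubset_iff_of_subset]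
    · refine ⟨X, by simp [hX, hi, hXY], ?_⟩
      simp only [Finset.mem_filter, not_and]
      intro _ h
      exact absurd h (lt_irrefl (X.sort (· ≤ ·)))
    · intro Z hZ
      simp only [Finset.mem_filter] at hZ ⊢
      exact ⟨hZ.1, lt_trans (show Z.sort (· ≤ ·) < X.sort (· ≤ ·) from hZ.2.1) hXY, hZ.2.2⟩
  intro X hX Y hY h
  simp only [Finset.coe_filter, Set.mem_ofPred_eq] at hX hY
  rcases lt_trichotomy (X.sort (· ≤ ·)) (Y.sort (· ≤ ·)) with h1 | h1 | h1
  · exact absurd h (key X hX.1 hX.2 Y h1).ne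
  · rw [← Finset.sort_toFinset (s := X) (r := (· ≤ ·)), h1, Finset.sort_toFinset]
  · exact absurd h (key Y hY.1 hY.2 X h1).ne'

/-- The sets containing `i` get for `i` precisely the indices `1, …, λ'_i`. -/
theorem image_indexOf {P : Finset (Finset ℕ+)} {lam : YoungDiagram} (ht : HasType P lam)
    (i : ℕ+) :
    (P.filter (fun X => i ∈ X)).image (fun X => indexOf P X i)
      = Finset.Icc 1 (conjPart lam i) := by
  refine Finset.eq_of_subset_of_card_le ?_ ?_
  · intro k hk
    obtain ⟨X, hX, rfl⟩ := Finset.mem_image.1 hk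
    rw [Finset.mem_filter] at hX
    rw [Finset.mem_Icc, ← ht i]
    refine ⟨Nat.succ_pos _, Finset.card_lt_card ?_⟩
    rw [Finset.ssubset_iff_of_subset]
    · refine ⟨X, by simp [hX], ?_⟩
      simp only [Finset.mem_filter, not_and]
      intro _ h
      exact absurd h (lt_irrefl (X.sort (· ≤ ·)))
    · intro Z hZ
      simp only [Finset.mem_filter] at hZ ⊢
      exact ⟨hZ.1, hZ.2.2⟩
  · rw [Finset.card_image_of_injOn (indexOf_injOn P i), Nat.card_Icc, ← ht i]
    exact le_rfl

theorem exists_symbol {P : Finset (Finset ℕ+)} {lam : YoungDiagram} (ht : HasType P lam)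
    {X : Finset ℕ+} (hX : X ∈ P) {i : ℕ+} (hi : i ∈ X) :
    ∃ s : Symbol lam, s ∈ indexedBlock lam P X ∧ s.number = i := by
  have h : indexOf P X i ∈ Finset.Icc 1 (conjPart lam i) := by
    rw [← image_indexOf ht i]
    exact Finset.mem_image_of_mem _ (by simp [hX, hi])
  rw [Finset.mem_Icc] at h
  refine ⟨⟨(i, ⟨indexOf P X i, h.1⟩), h.2⟩, ?_, rfl⟩
  exact Finset.mem_filter.2 ⟨Finset.mem_univ _, hi, rfl⟩

theorem card_indexedBlock {P : Finset (Finset ℕ+)} {lam : YoungDiagram} (ht : HasType P lam)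
    {X : Finset ℕ+} (hX : X ∈ P) : (indexedBlock lam P X).card = X.card := by
  refine Finset.card_bij (fun s _ => s.number) ?_ ?_ ?_
  · intro s hs
    exact (Finset.mem_filter.1 hs).2.1
  · intro s hs s' hs' h
    have h1 := (Finset.mem_filter.1 hs).2.2
    have h2 := (Finset.mem_filter.1 hs').2.2
    exact Subtype.ext (Prod.ext h (PNat.eq (by rw [← h, ← h1] at h2; exact h2.symm)))
  · intro i hi
    obtain ⟨s, hs, h⟩ := exists_symbol ht hX hi
    exact ⟨s, hs, h⟩

theorem eq_of_mem_indexedBlock {P : Finset (Finset ℕ+)} {lam : YoungDiagram}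
    {X Y : Finset ℕ+} (hX : X ∈ P) (hY : Y ∈ P) {s : Symbol lam}
    (h1 : s ∈ indexedBlock lam P X) (h2 : s ∈ indexedBlock lam P Y) : X = Y := by
  have h1 := (Finset.mem_filter.1 h1).2
  have h2 := (Finset.mem_filter.1 h2).2
  exact indexOf_injOn P s.number (by simp [hX, h1.1]) (by simp [hY, h2.1]) (h1.2.symm.trans h2.2)

/-- The indexed set partition associated to a set family of shape `(m^n)` and type `λ`. -/
def associatedPartition {m n : ℕ} (hm : 0 < m) {P : Finset (Finset ℕ+)} {lam : YoungDiagram}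
    (hP : IsSetFamily m n P) (ht : HasType P lam) : UniformPartition (Symbol lam) m n :=
  ⟨{ parts := P.image (indexedBlock lam P)
     supIndep := by
       rw [Finset.supIndep_iff_pairwiseDisjoint]
       intro B hB C hC hne
       obtain ⟨X, hX, rfl⟩ := Finset.mem_image.1 (Finset.mem_coe.1 hB)
       obtain ⟨Y, hY, rfl⟩ := Finset.mem_image.1 (Finset.mem_coe.1 hC)
       refine Finset.disjoint_left.2 fun s h1 h2 => hne ?_
       rw [eq_of_mem_indexedBlock hX hY h1 h2]
     sup_parts := by
       refine Finset.eq_univ_of_forall fun s => ?_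
       have h : (s.index : ℕ) ∈ Finset.Icc 1 (conjPart lam s.number) :=
         Finset.mem_Icc.2 ⟨s.index.pos, s.2⟩
       rw [← image_indexOf ht] at h
       obtain ⟨X, hX, h⟩ := Finset.mem_image.1 h
       rw [Finset.mem_filter] at hX
       exact Finset.mem_sup.2 ⟨_, Finset.mem_image_of_mem _ hX.1,
         Finset.mem_filter.2 ⟨Finset.mem_univ _, hX.2, h.symm⟩⟩
     bot_notMem := by
       intro h
       obtain ⟨X, hX, h⟩ := Finset.mem_image.1 h
       have h1 := card_indexedBlock ht hX
       rw [h, hP.card_mem X hX, Finset.bot_eq_empty, Finset.card_empty] at h1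
       omega },
   by
     refine (Finset.card_image_of_injOn ?_).trans hP.card_family
     intro X hX Y hY h
     have hpos : 0 < (indexedBlock lam P X).card := by
       rw [card_indexedBlock ht hX, hP.card_mem X hX]
       exact hm
     obtain ⟨s, hs⟩ := Finset.card_pos.1 hpos
     have hs' : s ∈ indexedBlock lam P Y := by
       rw [← show indexedBlock lam P X = indexedBlock lam P Y from h]
       exact hs
     exact eq_of_mem_indexedBlock hX hY hs hs',
   by
     intro B hB
     obtain ⟨X, hX, rfl⟩ := Finset.mem_image.1 hB
     exact (card_indexedBlock ht hX).trans (hP.card_mem X hX)⟩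

end Foulkes

/-! Call a vector a Specht vector for a Young shape if the column group acts on it by sign and it
satisfies the one-box Garnir relations: summing its images under exchanges of a box `b` with all
boxes of an earlier column returns the vector. Both `e_{t_λ}` and `u b_{t_λ}` are nonzero Specht
vectors. Any two nonzero Specht vectors `v`, `w` in torsion-free modules have the same annihilator
in the group ring, so `x v ↦ x w` is well defined and injective; uniqueness holds because the Specht
module is cyclic.

For the annihilators, take a Specht vector `z`. The relations make it an eigenvector of the central
sum of all transpositions, with eigenvalue determined by the shape. In a nonzero stable subgroup `N`
of the module generated by `z`, choose a row function `r` of least total whose symmetrizer does not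
kill `N`. Minimality gives dual relations for the symmetrized vector, and hence a second expression
for the eigenvalue. Comparing the two by counting pairs forces `r` to be a rearrangement of the true
row function, so the row symmetrizer does not kill `N` (`IsSpechtVector.eq_bot_of_rowSum`). Since
that symmetrizer maps the whole module into the multiples of one vector, a homomorphism to another
module that sends `z` to a nonzero Specht vector is injective on it. Applied to the two projections
of `(v, w)`, this identifies both annihilators with that of `(v, w)`.

For `u b_{t_λ}`, closedness supplies the set `X' = X \ {l} ∪ {j}` whenever `l ∈ X`, `j < l` and `j ∉
X`. Exchanging the symbol of `l` in the block of `X` with the symbol of `j` in that of `X'` can be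
undone by exchanging the remaining `m - 1` symbols of the two blocks within their columns. This is
even because `m` is odd (`exists_compensating_perm`), which suffices for the Garnir relations
(`isSpechtVector_colSum`). Distinctness of the sets gives nonvanishing. -/

namespace Foulkes

/-! ### Counting pairs in rows and columns -/

section Counting

variable {α : Type*} [Fintype α] [DecidableEq α]

/-- The number of ordered pairs of distinct elements on which `f` takes the same value. -/
def samePairs (f : α → ℕ) : ℕ := ∑ b, ∑ a, if a ≠ b ∧ f a = f b then 1 else 0

theorem samePairs_comp (f : α → ℕ) (g : Equiv.Perm α) : samePairs (f ∘ g) = samePairs f := by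
  unfold samePairs
  refine Fintype.sum_equiv g _ _ fun b => Fintype.sum_equiv g _ _ fun a => ?_
  simp

/-- The number of elements in the `f`-class of `b` on which `g` is smaller than at `b`. -/
def countBelow (f g : α → ℕ) (b : α) : ℕ := ({a | f a = f b ∧ g a < g b} : Finset α).card

/-- Since `g` separates the elements of each `f`-class, every pair in a class is counted in exactly
one of its two orders. -/
theorem two_mul_sum_countBelow {f g : α → ℕ} (h : ∀ a b, f a = f b → g a = g b → a = b) :
    2 * ∑ b, countBelow f g b = samePairs f := by
  have h1 : ∑ b, countBelow f g b = ∑ b, ∑ a, if f a = f b ∧ g a < g b then 1 else 0 := by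
    simp only [countBelow, Finset.card_filter]
  have h2 : ∑ b, countBelow f g b = ∑ b, ∑ a, if f a = f b ∧ g b < g a then 1 else 0 := by
    rw [h1, Finset.sum_comm]
    simp only [eq_comm]
  rw [two_mul]
  nth_rewrite 1 [h1]
  rw [h2, samePairs, ← Finset.sum_add_distrib]
  refine Finset.sum_congr rfl fun b _ => ?_
  rw [← Finset.sum_add_distrib]
  refine Finset.sum_congr rfl fun a _ => ?_
  by_cases hf : f a = f b
  · rcases lt_trichotomy (g a) (g b) with hg | hg | hg
    · have : a ≠ b := by rintro rfl; exact lt_irrefl _ hg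
      simp [hf, hg, hg.not_gt, this]
    · simp [h a b hf hg]
    · have : a ≠ b := by rintro rfl; exact lt_irrefl _ hg
      simp [hf, hg, hg.not_gt, this]
  · simp [hf]

omit [DecidableEq α] in
theorem countBelow_le {f g : α → ℕ} (h : ∀ a b, f a = f b → g a = g b → a = b) (b : α) :
    countBelow f g b ≤ g b := by
  rw [← Finset.card_range (g b)]
  refine Finset.card_le_card_of_injOn g ?_ ?_
  · intro a ha
    simp only [Finset.coe_filter, Finset.mem_univ, true_and, Set.mem_ofPred_eq] at ha
    simpa using ha.2
  · intro a ha a' ha' haa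
    simp only [Finset.coe_filter, Finset.mem_univ, true_and, Set.mem_ofPred_eq] at ha ha'
    exact h _ _ (ha.1.trans ha'.1.symm) haa

theorem countBelow_eq {f g : α → ℕ} (h : ∀ a b, f a = f b → g a = g b → a = b) {b : α}
    (hb : ∀ p < g b, ∃ a, f a = f b ∧ g a = p) : countBelow f g b = g b := by
  refine le_antisymm (countBelow_le h b) ?_
  nth_rewrite 1 [← Finset.card_range (g b)]
  refine Finset.card_le_card_of_surjOn g ?_
  intro p hp
  have hp : p < g b := by simpa using hp
  obtain ⟨a, h1, h2⟩ := hb p hp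
  exact ⟨a, by simp [h1, h2, hp], h2⟩

/-- The rows and columns of a finite set of boxes form a Young diagram. -/
structure IsYoungShape (row col : α → ℕ) : Prop where
  inj : ∀ a b, col a = col b → row a = row b → a = b
  up : ∀ b, ∀ p < row b, ∃ a, col a = col b ∧ row a = p
  left : ∀ b, ∀ i < col b, ∃ a, row a = row b ∧ col a = i

/-- A map that is injective on columns and has minimal sum is a column-preserving rearrangement
of the row map. -/
theorem IsYoungShape.exists_perm {row col : α → ℕ} (hS : IsYoungShape row col) {r : α → ℕ}
    (hr : ∀ a b, col a = col b → r a = r b → a = b) (hsum : ∑ b, r b ≤ ∑ b, row b) :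
    ∃ τ : Equiv.Perm α, (∀ a, col (τ a) = col a) ∧ ∀ a, row (τ a) = r a := by
  have h1 := two_mul_sum_countBelow hS.inj
  rw [Finset.sum_congr rfl fun b _ => countBelow_eq hS.inj (hS.up b)] at h1
  have h2 := two_mul_sum_countBelow hr
  -- Both `countBelow` sums are half of `samePairs col`, so `∑ row = ∑ countBelow col r ≤ ∑ r ≤ ∑
  -- row`, and the termwise inequality is an equality.
  have h3 : ∀ b, countBelow col r b = r b := by
    intro b
    refine (Finset.sum_eq_sum_iff_of_le (s := Finset.univ) fun b _ => countBelow_le hr b).1 ?_ b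
      (Finset.mem_univ b)
    refine le_antisymm (Finset.sum_le_sum fun b _ => countBelow_le hr b) ?_
    omega
  have h4 : ∀ b, ∃ a, col a = col b ∧ row a = r b := by
    intro b
    -- Otherwise the whole column of `b` lies above row `r b` and so has at most `r b` boxes. Yet `r
    -- b` of them are counted below `b`, and `b` itself is not counted.
    by_contra! hcon
    have hlt : ∀ a, col a = col b → row a < r b := by
      intro a ha
      by_contra! hge
      rcases hge.lt_or_eq with hlt | heq
      · obtain ⟨a', h5, h6⟩ := hS.up a _ hlt
        exact hcon a' (h5.trans ha) h6
      · exact hcon a ha heq.symm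
    have h5 : ({a | col a = col b} : Finset α).card ≤ r b := by
      rw [← Finset.card_range (r b)]
      refine Finset.card_le_card_of_injOn row ?_ ?_
      · intro a ha
        simp only [Finset.coe_filter, Finset.mem_univ, true_and, Set.mem_ofPred_eq] at ha
        simpa using hlt a ha
      · intro a ha a' ha' haa
        simp only [Finset.coe_filter, Finset.mem_univ, true_and, Set.mem_ofPred_eq] at ha ha'
        exact hS.inj _ _ (ha.trans ha'.symm) haa
    have h6 : countBelow col r b < ({a | col a = col b} : Finset α).card := by
      refine Finset.card_lt_card ((Finset.ssubset_iff_of_subset ?_).2 ⟨b, by simp, by simp⟩)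
      intro a
      simp +contextual
    rw [h3] at h6
    omega
  choose τ hτ using h4
  have hinj : Function.Injective τ := by
    intro a b hab
    refine hr a b ?_ ?_
    · rw [← (hτ a).1, hab, (hτ b).1]
    · rw [← (hτ a).2, hab, (hτ b).2]
  exact ⟨Equiv.ofBijective τ (Finite.injective_iff_bijective.1 hinj), fun a => (hτ a).1,
    fun a => (hτ a).2⟩

end Counting

/-! ### The sum of transpositions and Young symmetrizers -/

section Action

variable {α V : Type*} [Fintype α] [DecidableEq α] [AddCommGroup V]
  [DistribMulAction (Equiv.Perm α) V]

variable (α) in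
/-- The sum of all transpositions (and identities) `(a b)` applied to `v`. -/
def swapSum (v : V) : V := ∑ b : α, ∑ a : α, Equiv.swap a b • v

omit [Fintype α] [DecidableEq α] in
theorem refl_smul (v : V) : Equiv.refl α • v = v := one_smul (Equiv.Perm α) v

theorem swapSum_smul (σ : Equiv.Perm α) (v : V) : swapSum α (σ • v) = σ • swapSum α v := by
  unfold swapSum
  simp only [Finset.smul_sum]
  symm
  refine Fintype.sum_equiv σ _ _ fun b => Fintype.sum_equiv σ _ _ fun a => ?_
  rw [smul_smul, smul_smul, Equiv.mul_swap_eq_swap_mul]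

theorem swapSum_add (v w : V) : swapSum α (v + w) = swapSum α v + swapSum α w := by
  simp [swapSum, Finset.sum_add_distrib]

theorem swapSum_neg (v : V) : swapSum α (-v) = -swapSum α v := by
  simp [swapSum]

/-- The eigenvalue computation shared by column-alternating vectors (`ε = -1`) and row-symmetric
ones (`ε = 1`). Each `b` contributes one relation for each of the `f b` lower classes; the factor 2
comes from summing over ordered pairs. -/
theorem swapSum_eq (f : α → ℕ) (ε : ℤ) (v : V)
    (h1 : ∀ a b, a ≠ b → f a = f b → Equiv.swap a b • v = ε • v)
    (h2 : ∀ b, ∀ i < f b, ∑ a with f a = i, Equiv.swap a b • v = -(ε • v)) :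
    swapSum α v
      = ((Fintype.card α : ℤ) + ε * samePairs f - 2 * ε * (∑ b, f b : ℕ)) • v := by
  have hsplit : ∀ a b, Equiv.swap a b • v = (if a = b then v else 0)
      + (if a ≠ b ∧ f a = f b then (1 : ℕ) else 0) • (ε • v)
      + (if f a < f b then Equiv.swap a b • v else 0)
      + (if f b < f a then Equiv.swap a b • v else 0) := by
    intro a b
    by_cases hab : a = b
    · subst hab; simp [refl_smul]
    · rcases lt_trichotomy (f a) (f b) with h | h | h
      · simp [hab, h, h.ne, h.not_gt]
      · simp [hab, h, h1 a b hab h]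
      · simp [hab, h, h.ne', h.not_gt]
  have hlt : ∑ b, ∑ a, (if f a < f b then Equiv.swap a b • v else 0)
      = (∑ b, f b) • (-(ε • v)) := by
    rw [Finset.sum_smul]
    refine Finset.sum_congr rfl fun b _ => ?_
    rw [← Finset.sum_filter, ← Finset.sum_fiberwise_of_maps_to (t := Finset.range (f b)) (g := f)]
    · rw [Finset.sum_congr rfl (g := fun _ => -(ε • v)), Finset.sum_const, Finset.card_range]
      intro i hi
      rw [Finset.mem_range] at hi
      rw [← h2 b i hi, Finset.filter_filter]
      refine Finset.sum_congr (Finset.filter_congr fun a _ => ?_) fun _ _ => rfl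
      constructor
      · exact fun h => h.2
      · exact fun h => ⟨h ▸ hi, h⟩
    · intro a
      simp
  have hgt : ∑ b, ∑ a, (if f b < f a then Equiv.swap a b • v else 0)
      = (∑ b, f b) • (-(ε • v)) := by
    rw [← hlt, Finset.sum_comm]
    simp only [Equiv.swap_comm]
  have hself : ∑ b : α, ∑ a : α, (if a = b then v else 0) = Fintype.card α • v := by simp
  have hsame : ∑ b : α, ∑ a : α, (if a ≠ b ∧ f a = f b then (1 : ℕ) else 0) • (ε • v)
      = samePairs f • (ε • v) := by
    simp only [samePairs, Finset.sum_smul]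
  unfold swapSum
  rw [Finset.sum_congr rfl fun b _ => Finset.sum_congr rfl fun a _ => hsplit a b]
  simp only [Finset.sum_add_distrib]
  rw [hlt, hgt, hself, hsame]
  module

/-- The sum over the Young subgroup of permutations preserving `r`. -/
def rowSum (r : α → ℕ) : V →+ V :=
  ∑ σ : Equiv.Perm α with ∀ a, r (σ a) = r a, DistribSMul.toAddMonoidHom V σ

theorem rowSum_apply (r : α → ℕ) (v : V) :
    rowSum r v = ∑ σ : Equiv.Perm α with ∀ a, r (σ a) = r a, σ • v := by
  simp [rowSum]

theorem rowSum_eq_sum_ite (r : α → ℕ) (v : V) :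
    rowSum r v = ∑ σ : Equiv.Perm α, if ∀ a, r (σ a) = r a then σ • v else 0 := by
  rw [rowSum_apply, Finset.sum_filter]

theorem smul_rowSum {r : α → ℕ} {τ : Equiv.Perm α} (hτ : ∀ a, r (τ a) = r a) (v : V) :
    τ • rowSum r v = rowSum r v := by
  rw [rowSum_eq_sum_ite, Finset.smul_sum]
  refine Fintype.sum_equiv (Equiv.mulLeft τ) _ _ fun σ => ?_
  simp only [Equiv.coe_mulLeft, Equiv.Perm.mul_apply, hτ, mul_smul]
  split_ifs <;> simp

theorem rowSum_smul {r : α → ℕ} {τ : Equiv.Perm α} (hτ : ∀ a, r (τ a) = r a) (v : V) :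
    rowSum r (τ • v) = rowSum r v := by
  rw [rowSum_eq_sum_ite, rowSum_eq_sum_ite]
  refine Fintype.sum_equiv (Equiv.mulRight τ) _ _ fun σ => ?_
  have : (∀ a, r (σ (τ a)) = r a) ↔ ∀ a, r (σ a) = r a := by
    constructor
    · intro h a
      have := h (τ⁻¹ a)
      rw [Equiv.Perm.coe_inv, Equiv.apply_symm_apply] at this
      rw [this, ← hτ (τ.symm a), Equiv.apply_symm_apply]
    · intro h a
      rw [h, hτ]
  simp only [Equiv.coe_mulRight, Equiv.Perm.mul_apply, this, mul_smul]

theorem rowSum_comp (r : α → ℕ) (g : Equiv.Perm α) (v : V) :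
    rowSum (r ∘ g) v = g⁻¹ • rowSum r (g • v) := by
  rw [rowSum_eq_sum_ite, rowSum_eq_sum_ite, Finset.smul_sum]
  refine Fintype.sum_equiv (MulAut.conj g).toEquiv _ _ fun σ => ?_
  have : (∀ a, r (g (σ (g⁻¹ a))) = r a) ↔ ∀ a, r (g (σ a)) = r (g a) := by
    constructor
    · intro h a
      simpa using h (g a)
    · intro h a
      simpa using h (g⁻¹ a)
  simp only [MulEquiv.toEquiv_eq_coe, EquivLike.coe_coe, MulAut.conj_apply,
    Equiv.Perm.mul_apply, this, Function.comp_apply]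
  split_ifs
  · simp [mul_smul]
  · simp

theorem rowSum_of_injective {r : α → ℕ} (hr : Function.Injective r) (v : V) :
    rowSum r v = v := by
  rw [rowSum_apply, Finset.sum_eq_single_of_mem 1 (by simp)]
  · simp
  · intro σ hσ hne
    refine absurd (Equiv.ext fun a => hr ?_) hne
    simpa using (Finset.mem_filter.1 hσ).2 a

/-- Symmetrizing a vector fixed by the Young subgroup of `r` over the Young subgroup in which `b`
has been moved to the class `p`. -/
theorem rowSum_update {r : α → ℕ} {v : V} (hv : ∀ σ : Equiv.Perm α, (∀ a, r (σ a) = r a) → σ • v = v)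
    {b : α} {p : ℕ} (hp : p ≠ r b) :
    ∃ k : ℕ, k ≠ 0 ∧
      rowSum (Function.update r b p) v = k • (v + ∑ a with r a = p, Equiv.swap a b • v) := by
  set r' := Function.update r b p with hr'
  have hr'b : r' b = p := by simp [hr']
  have hr'ne : ∀ a, a ≠ b → r' a = r a := fun a ha => by simp [hr', ha]
  -- The stabilizer of `b` in the new Young subgroup. It also preserves `r`, so it fixes `v`; the
  -- exchanges of `b` with members of its new class are coset representatives, and the multiplicity
  -- `k` is the order of `S`.
  let S : Finset (Equiv.Perm α) := {σ | (∀ a, r' (σ a) = r' a) ∧ σ b = b}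
  have hfib : ∀ a, r' a = p →
      ∑ σ : Equiv.Perm α with (∀ a, r' (σ a) = r' a) ∧ σ b = a, σ • v
        = S.card • (Equiv.swap a b • v) := by
    intro a ha
    have hsw : ∀ c, r' (Equiv.swap a b c) = r' c := by
      intro c
      by_cases h1 : c = a
      · subst h1; simp [ha, hr'b]
      · by_cases h2 : c = b
        · subst h2; simp [ha, hr'b]
        · rw [Equiv.swap_apply_of_ne_of_ne h1 h2]
    rw [← Finset.sum_const]
    symm
    refine Finset.sum_bij (fun σ _ => Equiv.swap a b * σ) ?_ ?_ ?_ ?_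
    · intro σ hσ
      simp only [S, Finset.mem_filter, Finset.mem_univ, true_and] at hσ ⊢
      exact ⟨fun c => by simp [hsw, hσ.1], by simp [hσ.2]⟩
    · intro σ _ τ _ h
      exact mul_left_cancel h
    · intro σ hσ
      simp only [S, Finset.mem_filter, Finset.mem_univ, true_and] at hσ ⊢
      exact ⟨Equiv.swap a b * σ, ⟨fun c => by simp [hsw, hσ.1], by simp [hσ.2]⟩, by simp⟩
    · intro σ hσ
      simp only [S, Finset.mem_filter, Finset.mem_univ, true_and] at hσ
      rw [mul_smul, hv σ]
      intro c
      by_cases h2 : c = b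
      · rw [h2, hσ.2]
      · have h3 : σ c ≠ b := fun h => h2 (σ.injective (h.trans hσ.2.symm))
        rw [← hr'ne _ h3, ← hr'ne _ h2, hσ.1]
  refine ⟨S.card, Finset.card_ne_zero_of_mem (a := 1) (by simp [S]), ?_⟩
  rw [rowSum_apply, ← Finset.sum_fiberwise_of_maps_to
    (t := insert b ({a | r a = p} : Finset α)) (g := fun σ => σ b)]
  · rw [Finset.sum_insert (by simpa using hp.symm), smul_add, Finset.smul_sum]
    congr 1
    · rw [Finset.filter_filter, hfib b hr'b]
      simp [refl_smul]
    · refine Finset.sum_congr rfl fun a ha => ?_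
      have ha : r a = p := by simpa using ha
      rw [Finset.filter_filter, hfib a]
      rw [hr'ne, ha]
      rintro rfl
      exact hp ha.symm
  · intro σ hσ
    have h := (Finset.mem_filter.1 hσ).2 b
    simp only [Finset.mem_insert, Finset.mem_filter, Finset.mem_univ, true_and]
    by_cases h2 : σ b = b
    · exact Or.inl h2
    · right
      rwa [hr'b, hr'ne _ h2] at h

end Action

/-! ### Submodules generated by a Specht vector -/

section Core

variable {α V : Type*} [Fintype α] [DecidableEq α] [AddCommGroup V]
  [DistribMulAction (Equiv.Perm α) V]

/-- A vector that is alternating for the column group and satisfies the one-box Garnir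
relations. -/
structure IsSpechtVector (col : α → ℕ) (z : V) : Prop where
  sign_smul : ∀ τ : Equiv.Perm α, (∀ a, col (τ a) = col a) → τ • z = (Equiv.Perm.sign τ : ℤ) • z
  garnir : ∀ b, ∀ i < col b, ∑ a with col a = i, Equiv.swap a b • z = z

theorem IsSpechtVector.swap_smul {col : α → ℕ} {z : V} (hz : IsSpechtVector col z) {a b : α}
    (hab : a ≠ b) (h : col a = col b) : Equiv.swap a b • z = -z := by
  rw [hz.sign_smul, Equiv.Perm.sign_swap hab]
  · simp
  · intro c
    by_cases h1 : c = a
    · subst h1; simp [h]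
    · by_cases h2 : c = b
      · subst h2; simp [h]
      · rw [Equiv.swap_apply_of_ne_of_ne h1 h2]

theorem IsSpechtVector.swapSum_eq {col : α → ℕ} {z : V} (hz : IsSpechtVector col z) :
    swapSum α z
      = ((Fintype.card α : ℤ) - samePairs col + 2 * (∑ b, col b : ℕ)) • z := by
  rw [Foulkes.swapSum_eq col (-1) z]
  · congr 1
    ring
  · intro a b hab h
    rw [hz.swap_smul hab h, neg_one_zsmul]
  · intro b i hi
    rw [hz.garnir b i hi, neg_one_zsmul, neg_neg]

theorem swapSum_eq_of_mem_closure {z x : V} {c : ℤ} (hz : swapSum α z = c • z)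
    (hx : x ∈ AddSubgroup.closure (MulAction.orbit (Equiv.Perm α) z)) :
    swapSum α x = c • x := by
  induction hx using AddSubgroup.closure_induction with
  | mem x hx =>
    obtain ⟨g, rfl⟩ := hx
    change swapSum α (g • z) = c • g • z
    rw [swapSum_smul, hz, smul_comm]
  | zero => simp [swapSum]
  | add x y _ _ hx hy => rw [swapSum_add, hx, hy, smul_add]
  | neg x _ hx => rw [swapSum_neg, hx, smul_neg]

omit [Fintype α] [DecidableEq α] in
theorem smul_mem_closure {z x : V}
    (hx : x ∈ AddSubgroup.closure (MulAction.orbit (Equiv.Perm α) z)) (σ : Equiv.Perm α) :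
    σ • x ∈ AddSubgroup.closure (MulAction.orbit (Equiv.Perm α) z) := by
  have : AddSubgroup.closure (MulAction.orbit (Equiv.Perm α) z)
      ≤ (AddSubgroup.closure (MulAction.orbit (Equiv.Perm α) z)).comap
        (DistribSMul.toAddMonoidHom V σ) := by
    rw [AddSubgroup.closure_le]
    rintro _ ⟨g, rfl⟩
    exact AddSubgroup.subset_closure ⟨σ * g, mul_smul σ g z⟩
  exact this hx

theorem exists_smul_of_mem_closure {z x : V} {r : α → ℕ}
    (hx : x ∈ AddSubgroup.closure (MulAction.orbit (Equiv.Perm α) z)) (h : rowSum r x ≠ 0) :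
    ∃ g : Equiv.Perm α, rowSum r (g • z) ≠ 0 := by
  by_contra! hcon
  refine h ?_
  have : AddSubgroup.closure (MulAction.orbit (Equiv.Perm α) z) ≤ (rowSum (V := V) r).ker := by
    rw [AddSubgroup.closure_le]
    rintro _ ⟨g, rfl⟩
    exact hcon g
  exact this hx

variable [IsAddTorsionFree V]

/-- Two boxes of one column landing in the same `r`-class would give a transposition that the
symmetrizer absorbs but that negates `z`; the symmetrized vector would equal its own negative. -/
theorem IsSpechtVector.injective_of_rowSum_ne_zero {col : α → ℕ} {z : V}
    (hz : IsSpechtVector col z) {r : α → ℕ} {g : Equiv.Perm α} (hr : rowSum r (g • z) ≠ 0)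
    (a b : α) (hcol : col a = col b) (hrow : r (g a) = r (g b)) : a = b := by
  by_contra hab
  have h1 : rowSum r (Equiv.swap (g a) (g b) • g • z) = rowSum r (g • z) := by
    refine rowSum_smul (fun c => ?_) _
    by_cases h1 : c = g a
    · subst h1; simp [hrow]
    · by_cases h2 : c = g b
      · subst h2; simp [hrow]
      · rw [Equiv.swap_apply_of_ne_of_ne h1 h2]
  rw [smul_smul, ← Equiv.mul_swap_eq_swap_mul, mul_smul, hz.swap_smul hab hcol, smul_neg,
    map_neg] at h1
  exact hr (self_eq_neg.1 h1.symm)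

/-- The row symmetrizer detects every nonzero submodule of the module generated by a Specht
vector. -/
theorem IsSpechtVector.eq_bot_of_rowSum {row col : α → ℕ} (hS : IsYoungShape row col) {z : V}
    (hz : IsSpechtVector col z) (N : AddSubgroup V)
    (hN : ∀ (σ : Equiv.Perm α), ∀ x ∈ N, σ • x ∈ N)
    (hNz : N ≤ AddSubgroup.closure (MulAction.orbit (Equiv.Perm α) z))
    (h0 : ∀ x ∈ N, rowSum row x = 0) : N = ⊥ := by
  by_contra hbot
  obtain ⟨⟨x₀, hx₀⟩, hne⟩ := AddSubgroup.ne_bot_iff_exists_ne_zero.1 hbot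
  have hx₀ne : x₀ ≠ 0 := fun h => hne (Subtype.ext h)
  -- An injective `r` has trivial Young subgroup, so its symmetrizer is the identity and a minimal
  -- total exists.
  have hex : ∃ s, ∃ r : α → ℕ, ∑ b, r b = s ∧ ∃ x ∈ N, rowSum r x ≠ 0 := by
    refine ⟨_, fun a => Fintype.equivFin α a, rfl, x₀, hx₀, ?_⟩
    rw [rowSum_of_injective]
    · exact hx₀ne
    · exact Fin.val_injective.comp (Fintype.equivFin α).injective
  classical
  obtain ⟨r, hrsum, x, hxN, hrx⟩ := Nat.find_spec hex
  have hmin : ∀ r' : α → ℕ, ∑ b, r' b < ∑ b, r b → ∀ x ∈ N, rowSum r' x = 0 := by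
    intro r' hlt x hx
    by_contra hne
    exact Nat.find_min hex (hrsum ▸ hlt) ⟨r', rfl, x, hx, hne⟩
  set y := rowSum r x with hy
  have hyN : y ∈ N := by
    rw [hy, rowSum_apply]
    exact sum_mem fun σ _ => hN σ x hxN
  have hyfix : ∀ σ : Equiv.Perm α, (∀ a, r (σ a) = r a) → σ • y = y :=
    fun σ hσ => smul_rowSum hσ x
  have hyT : swapSum α y
      = ((Fintype.card α : ℤ) + 1 * samePairs r - 2 * 1 * (∑ b, r b : ℕ)) • y := by
    refine Foulkes.swapSum_eq r 1 y ?_ ?_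
    · intro a b hab h
      rw [one_zsmul, hyfix]
      intro c
      by_cases h1 : c = a
      · subst h1; simp [h]
      · by_cases h2 : c = b
        · subst h2; simp [h]
        · rw [Equiv.swap_apply_of_ne_of_ne h1 h2]
    -- Moving `b` down to class `p` lowers the total, so by minimality the new symmetrizer kills
    -- `y`; cancelling `k` leaves the dual Garnir relation.
    · intro b p hp
      obtain ⟨k, hk, hsum⟩ := rowSum_update hyfix hp.ne
      rw [hmin _ ?_ y hyN] at hsum
      · rw [one_zsmul]
        exact eq_neg_of_add_eq_zero_right ((smul_eq_zero.1 hsum.symm).resolve_left hk)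
      · refine Finset.sum_lt_sum (fun a _ => ?_) ⟨b, Finset.mem_univ b, by simpa using hp⟩
        by_cases h : a = b
        · subst h; simpa using hp.le
        · simp [h]
  rw [swapSum_eq_of_mem_closure hz.swapSum_eq (hNz hyN)] at hyT
  -- The two eigenvalues agree: `2 ∑ col - samePairs col = samePairs r - 2 ∑ r`. Below, `samePairs r
  -- ≤ 2 ∑ col` and `samePairs col = 2 ∑ row`, whence `∑ r ≤ ∑ row`.
  have hc := smul_left_injective ℤ hrx hyT
  obtain ⟨g, hg⟩ := exists_smul_of_mem_closure (hNz hxN) hrx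
  have hinj : ∀ a b, col a = col b → (r ∘ g) a = (r ∘ g) b → a = b :=
    hz.injective_of_rowSum_ne_zero hg
  have h1 := two_mul_sum_countBelow (f := r ∘ g) (g := col) fun a b h h' => hinj a b h' h
  have h2 : ∑ b, countBelow (r ∘ g) col b ≤ ∑ b, col b :=
    Finset.sum_le_sum fun b _ => countBelow_le (fun a b h h' => hinj a b h' h) b
  have h3 := two_mul_sum_countBelow hS.inj
  rw [Finset.sum_congr rfl fun b _ => countBelow_eq hS.inj (hS.up b)] at h3
  have h4 : ∑ b, (r ∘ g) b = ∑ b, r b := Equiv.sum_comp g r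
  rw [samePairs_comp] at h1
  obtain ⟨τ, -, hτ⟩ := hS.exists_perm hinj (by omega)
  have h5 : r = row ∘ (τ * g⁻¹ : Equiv.Perm α) := by
    funext a
    simp [hτ]
  rw [hy, h5, rowSum_comp, h0 _ (hN _ _ hxN), smul_zero] at hrx
  exact hrx rfl

/-- If the row symmetrizer does not kill `g • z`, then `row ∘ g` is injective on columns with the
same total as `row`, so `g` is a row permutation times a column permutation. The former is absorbed
and the latter gives a sign. -/
theorem IsSpechtVector.exists_rowSum_eq {row col : α → ℕ} (hS : IsYoungShape row col) {z : V}
    (hz : IsSpechtVector col z) {x : V}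
    (hx : x ∈ AddSubgroup.closure (MulAction.orbit (Equiv.Perm α) z)) :
    ∃ k : ℤ, rowSum row x = k • rowSum row z := by
  have : AddSubgroup.closure (MulAction.orbit (Equiv.Perm α) z)
      ≤ (AddSubgroup.zmultiples (rowSum row z)).comap (rowSum (V := V) row) := by
    rw [AddSubgroup.closure_le]
    rintro _ ⟨g, rfl⟩
    change rowSum row (g • z) ∈ AddSubgroup.zmultiples (rowSum row z)
    by_cases h : rowSum row (g • z) = 0
    · rw [h]
      exact zero_mem _
    · obtain ⟨τ, hτcol, hτ⟩ := hS.exists_perm (r := row ∘ g)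
        (hz.injective_of_rowSum_ne_zero h) (Equiv.sum_comp g row).le
      have h1 : rowSum row ((g * τ⁻¹) • τ • z) = rowSum row (τ • z) := by
        refine rowSum_smul (fun a => ?_) _
        have := hτ (τ⁻¹ a)
        simpa using this.symm
      rw [smul_smul, inv_mul_cancel_right, hz.sign_smul τ hτcol, map_zsmul] at h1
      exact ⟨_, h1.symm⟩
  obtain ⟨k, hk⟩ := this hx
  exact ⟨k, hk.symm⟩

/-- If the symmetrizer killed `z` it would kill everything generated by `z`, contrary to its
detecting nonzero submodules. -/
theorem IsSpechtVector.rowSum_ne_zero {row col : α → ℕ} (hS : IsYoungShape row col) {z : V}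
    (hz : IsSpechtVector col z) (h : z ≠ 0) : rowSum row z ≠ 0 := by
  intro h0
  have hmem : z ∈ AddSubgroup.closure (MulAction.orbit (Equiv.Perm α) z) :=
    AddSubgroup.subset_closure (MulAction.mem_orbit_self z)
  rw [hz.eq_bot_of_rowSum hS _ (fun σ x hx => ?_) le_rfl fun x hx => ?_] at hmem
  · exact h hmem
  · exact smul_mem_closure hx σ
  · obtain ⟨k, hk⟩ := hz.exists_rowSum_eq hS hx
    rw [hk, h0, smul_zero]

end Core

/-! ### Passage to modules over the group ring -/

section Module

variable {α V W : Type*} [Fintype α] [DecidableEq α] [AddCommGroup V] [AddCommGroup W]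
  [Module ℤ[Equiv.Perm α] V] [Module ℤ[Equiv.Perm α] W]

/-- The action of the group underlying a module over its group ring. -/
noncomputable abbrev groupAction (α V : Type*) [AddCommGroup V] [Module ℤ[Equiv.Perm α] V] :
    DistribMulAction (Equiv.Perm α) V :=
  DistribMulAction.compHom V (MonoidAlgebra.of ℤ (Equiv.Perm α))

attribute [local instance] groupAction

omit [Fintype α] [DecidableEq α] in
theorem smul_mem_closure_orbit (x : ℤ[Equiv.Perm α]) (z : V) :
    x • z ∈ AddSubgroup.closure (MulAction.orbit (Equiv.Perm α) z) := by
  induction x using MonoidAlgebra.induction_on with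
  | of g => exact AddSubgroup.subset_closure ⟨g, rfl⟩
  | add f g hf hg => rw [add_smul]; exact add_mem hf hg
  | smul r f hf => rw [smul_assoc]; exact zsmul_mem hf r

omit [Fintype α] [DecidableEq α] in
theorem map_perm_smul (φ : V →ₗ[ℤ[Equiv.Perm α]] W) (σ : Equiv.Perm α) (v : V) :
    φ (σ • v) = σ • φ v := map_smul φ _ v

theorem map_rowSum (φ : V →ₗ[ℤ[Equiv.Perm α]] W) (r : α → ℕ) (v : V) :
    φ (rowSum r v) = rowSum r (φ v) := by
  simp only [rowSum_apply, map_sum, map_perm_smul]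

/-- A homomorphism that does not kill a Specht vector is injective on the module it generates. -/
theorem IsSpechtVector.smul_eq_zero_of_map [IsAddTorsionFree V] [IsAddTorsionFree W]
    {row col : α → ℕ} (hS : IsYoungShape row col) {z : V} (hz : IsSpechtVector col z)
    (φ : V →ₗ[ℤ[Equiv.Perm α]] W) (hφ : IsSpechtVector col (φ z)) (hne : φ z ≠ 0)
    {x : ℤ[Equiv.Perm α]} (hx : x • φ z = 0) : x • z = 0 := by
  let N : AddSubgroup V :=
    AddSubgroup.closure (MulAction.orbit (Equiv.Perm α) z) ⊓ φ.toAddMonoidHom.ker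
  have hbot : N = ⊥ := by
    refine hz.eq_bot_of_rowSum hS N ?_ inf_le_left ?_
    · rintro σ y ⟨hy, hy'⟩
      refine ⟨?_, ?_⟩
      · exact smul_mem_closure hy σ
      · change φ (σ • y) = 0
        rw [map_perm_smul, show φ y = 0 from hy', smul_zero]
    · rintro y ⟨hy, hy'⟩
      obtain ⟨k, hk⟩ := hz.exists_rowSum_eq hS hy
      -- The multiple `k` survives under `φ`, where the symmetrized image of `z` is nonzero, so `k =
      -- 0`.
      have h1 : k • rowSum row (φ z) = 0 := by
        rw [← map_rowSum, ← map_zsmul, ← hk, map_rowSum, show φ y = 0 from hy', map_zero]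
      rw [hk, (smul_eq_zero.1 h1).resolve_right (hφ.rowSum_ne_zero hS hne), zero_smul]
  have hmem : x • z ∈ N := ⟨smul_mem_closure_orbit x z, by
    change φ (x • z) = 0
    rw [map_smul, hx]⟩
  rw [hbot] at hmem
  exact hmem

end Module

/-! ### A criterion for column antisymmetrizations to be Specht vectors -/

section ColumnSum

variable {α V : Type*} [Fintype α] [DecidableEq α] [AddCommGroup V]
  [DistribMulAction (Equiv.Perm α) V]

/-- The signed sum over the group of permutations preserving `col`. -/
def colSum (col : α → ℕ) (u : V) : V :=
  ∑ τ : Equiv.Perm α with ∀ a, col (τ a) = col a, (Equiv.Perm.sign τ : ℤ) • τ • u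

theorem smul_colSum {col : α → ℕ} {σ : Equiv.Perm α} (hσ : ∀ a, col (σ a) = col a) (u : V) :
    σ • colSum col u = (Equiv.Perm.sign σ : ℤ) • colSum col u := by
  unfold colSum
  rw [Finset.smul_sum, Finset.smul_sum]
  refine Finset.sum_equiv (Equiv.mulLeft σ) (fun τ => ?_) fun τ _ => ?_
  · simp [hσ]
  · rw [Equiv.coe_mulLeft, smul_comm σ, smul_smul σ, smul_smul, map_mul, Units.val_mul,
      ← mul_assoc, ← Units.val_mul, Int.units_mul_self, Units.val_one, one_mul]

/-- If moving the box `b` into column `i` can be compensated, up to an even column permutation, by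
exchanging `b` with some box of that column, then the column antisymmetrization of `u` is a
Specht vector. -/
theorem isSpechtVector_colSum [IsAddTorsionFree V] {col : α → ℕ} {u : V}
    (h : ∀ b, ∀ i < col b, ∃ a, col a = i ∧ ∃ π : Equiv.Perm α, (∀ c, col (π c) = col c) ∧
      Equiv.Perm.sign π = 1 ∧ π a = a ∧ π b = b ∧ π • Equiv.swap a b • u = u) :
    IsSpechtVector col (colSum col u) := by
  refine ⟨fun τ hτ => smul_colSum hτ u, fun b i hi => ?_⟩
  have h' : ∀ c, ∃ a, ∃ π : Equiv.Perm α, col c = col b → (col a = i ∧ (∀ c, col (π c) = col c) ∧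
      Equiv.Perm.sign π = 1 ∧ π a = a ∧ π c = c ∧ π • Equiv.swap a c • u = u) := by
    intro c
    by_cases hc : col c = col b
    · obtain ⟨a, ha, π, hπ⟩ := h c i (hc ▸ hi)
      exact ⟨a, π, fun _ => ⟨ha, hπ⟩⟩
    · exact ⟨b, 1, fun h => absurd h hc⟩
  choose φ π hφ using h'
  have hinv : ∀ τ : Equiv.Perm α, (∀ a, col (τ a) = col a) → ∀ a, col (τ⁻¹ a) = col a := by
    intro τ hτ a
    rw [← hτ (τ⁻¹ a)]
    simp
  -- Column permutations are sorted by where they send the partner of the box that goes to `b`; this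
  -- place `j` lies in column `i`.
  let C (j : α) : Finset (Equiv.Perm α) := {τ | (∀ a, col (τ a) = col a) ∧ τ (φ (τ⁻¹ b)) = j}
  have hC : ∀ j τ, τ ∈ C j ↔ (∀ a, col (τ a) = col a) ∧ τ (φ (τ⁻¹ b)) = j := by
    intro j τ
    simp [C]
  let w (j : α) : V := ∑ τ ∈ C j, (Equiv.Perm.sign τ : ℤ) • τ • u
  have hw : colSum col u = ∑ j with col j = i, w j := by
    unfold colSum
    rw [← Finset.sum_fiberwise_of_maps_to (t := ({j | col j = i} : Finset α))
      (g := fun τ : Equiv.Perm α => τ (φ (τ⁻¹ b)))]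
    · refine Finset.sum_congr rfl fun j _ => ?_
      rw [Finset.filter_filter]
    · intro τ hτ
      have hτ : ∀ a, col (τ a) = col a := by simpa using hτ
      simpa [hτ] using (hφ _ (hinv τ hτ b)).1
  -- Moving the exchange past `τ` turns it into the exchange of `τ⁻¹ b` with its partner, which acts
  -- on `u` as `π⁻¹`. As `π` is even and fixes both boxes, `τ ↦ τ π⁻¹` preserves signs and the class
  -- `C j`.
  have hA : ∀ j, Equiv.swap j b • w j = w j := by
    intro j
    simp only [w, Finset.smul_sum]
    refine Finset.sum_bij' (fun τ _ => τ * (π (τ⁻¹ b))⁻¹) (fun τ _ => τ * π (τ⁻¹ b)) ?_ ?_ ?_ ?_ ?_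
    · intro τ hτ
      obtain ⟨h1, h2⟩ := (hC j τ).1 hτ
      obtain ⟨ha, hp, hs, h3, h4, h5⟩ := hφ _ (hinv τ h1 b)
      have h4' : (π (τ⁻¹ b)) (τ⁻¹ b) = τ⁻¹ b := h4
      have h6 : (τ * (π (τ⁻¹ b))⁻¹)⁻¹ b = τ⁻¹ b := by simpa using h4'
      rw [hC, h6]
      refine ⟨fun a => ?_, ?_⟩
      · rw [Equiv.Perm.mul_apply, h1, hinv _ hp]
      · rw [Equiv.Perm.mul_apply, Equiv.Perm.inv_eq_iff_eq.2 h3.symm, h2]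
    · intro τ hτ
      obtain ⟨h1, h2⟩ := (hC j τ).1 hτ
      obtain ⟨ha, hp, hs, h3, h4, h5⟩ := hφ _ (hinv τ h1 b)
      have h6 : (τ * π (τ⁻¹ b))⁻¹ b = τ⁻¹ b := by
        rw [mul_inv_rev, Equiv.Perm.mul_apply, Equiv.Perm.inv_eq_iff_eq.2 h4.symm]
      rw [hC, h6]
      refine ⟨fun a => ?_, ?_⟩
      · rw [Equiv.Perm.mul_apply, h1, hp]
      · rw [Equiv.Perm.mul_apply, h3, h2]
    · intro τ hτ
      obtain ⟨h1, h2⟩ := (hC j τ).1 hτ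
      obtain ⟨ha, hp, hs, h3, h4, h5⟩ := hφ _ (hinv τ h1 b)
      have h6 : (τ * (π (τ⁻¹ b))⁻¹)⁻¹ b = τ⁻¹ b := by simpa using h4
      rw [h6, inv_mul_cancel_right]
    · intro τ hτ
      obtain ⟨h1, h2⟩ := (hC j τ).1 hτ
      obtain ⟨ha, hp, hs, h3, h4, h5⟩ := hφ _ (hinv τ h1 b)
      have h6 : (τ * π (τ⁻¹ b))⁻¹ b = τ⁻¹ b := by
        rw [mul_inv_rev, Equiv.Perm.mul_apply, Equiv.Perm.inv_eq_iff_eq.2 h4.symm]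
      rw [h6, mul_inv_cancel_right]
    · intro τ hτ
      obtain ⟨h1, h2⟩ := (hC j τ).1 hτ
      obtain ⟨ha, hp, hs, h3, h4, h5⟩ := hφ _ (hinv τ h1 b)
      have h6 : Equiv.swap j b * τ = τ * Equiv.swap (φ (τ⁻¹ b)) (τ⁻¹ b) := by
        rw [Equiv.mul_swap_eq_swap_mul, h2]
        simp
      rw [smul_comm, smul_smul (Equiv.swap j b), h6, mul_smul, mul_smul, map_mul,
        Equiv.Perm.sign_inv, hs, mul_one]
      congr 2
      rw [eq_inv_smul_iff, h5]
  have hB : ∀ j j', col j = i → col j' = i → j ≠ j' → Equiv.swap j j' • w j = -w j' := by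
    intro j j' hj hj' hne
    have hcol : ∀ c, col (Equiv.swap j j' c) = col c := by
      intro c
      by_cases h1 : c = j
      · subst h1; simp [hj, hj']
      · by_cases h2 : c = j'
        · subst h2; simp [hj, hj']
        · rw [Equiv.swap_apply_of_ne_of_ne h1 h2]
    have hb : Equiv.swap j j' b = b := by
      refine Equiv.swap_apply_of_ne_of_ne ?_ ?_ <;> rintro rfl <;> omega
    simp only [w, Finset.smul_sum, ← Finset.sum_neg_distrib]
    refine Finset.sum_equiv (Equiv.mulLeft (Equiv.swap j j')) (fun τ => ?_) fun τ _ => ?_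
    · rw [hC, hC, Equiv.coe_mulLeft, mul_inv_rev, Equiv.swap_inv, Equiv.Perm.mul_apply τ⁻¹, hb,
        Equiv.Perm.mul_apply, Equiv.swap_apply_eq_iff, Equiv.swap_apply_right]
      simp [hcol]
    · rw [Equiv.coe_mulLeft, smul_comm, smul_smul (Equiv.swap j j'), map_mul,
        Equiv.Perm.sign_swap hne, Units.val_mul]
      simp
  -- The Garnir sum is the double sum of `F`. Its off-diagonal terms are antisymmetric and its
  -- diagonal terms are the `w j`, so adding the transposed sum gives twice the claim, and
  -- torsion-freeness removes the 2.
  let F (j j' : α) : V := Equiv.swap j b • w j'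
  have hF : ∀ j j', col j = i → col j' = i → F j j' + F j' j = if j = j' then 2 • w j else 0 := by
    intro j j' hj hj'
    by_cases hne : j = j'
    · subst hne
      simp [F, hA, two_nsmul]
    · have hjb : j ≠ b := by rintro rfl; omega
      have h1 : Equiv.swap j b * Equiv.swap j' b = Equiv.swap j' b * Equiv.swap j' j := by
        rw [Equiv.mul_swap_eq_swap_mul (Equiv.swap j' b) j' j, Equiv.swap_apply_left,
          Equiv.swap_apply_of_ne_of_ne hne hjb, Equiv.swap_comm b j]
      have h2 : F j j' = -F j' j := by
        simp only [F]
        nth_rewrite 1 [← hA j']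
        rw [smul_smul, h1, mul_smul, hB j' j hj' hj (Ne.symm hne), smul_neg]
      simp [hne, h2]
  have h2 : 2 • ∑ j with col j = i, ∑ j' with col j' = i, F j j'
      = 2 • ∑ j with col j = i, w j := by
    rw [two_nsmul]
    nth_rewrite 2 [Finset.sum_comm]
    rw [← Finset.sum_add_distrib, Finset.smul_sum]
    refine Finset.sum_congr rfl fun j hj => ?_
    rw [← Finset.sum_add_distrib]
    have hj' : col j = i := by simpa using hj
    rw [Finset.sum_congr rfl fun j' hj' => hF j j' (by simpa using hj) (by simpa using hj')]
    simp [hj']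
  rw [hw]
  simp only [Finset.smul_sum]
  exact nsmul_right_injective two_ne_zero h2

end ColumnSum

/-! ### Coefficients in permutation modules -/

section PermModule

variable {G X : Type} [Group G] [MulAction G X]

theorem of_smul_basisVector (g : G) (x : X) :
    MonoidAlgebra.of ℤ G g • basisVector G x = basisVector G (g • x) := by
  rw [basisVector, ← Representation.asModuleEquiv_symm_map_rho, Representation.ofMulAction_single,
    basisVector]

/-- The coefficient of a basis element. -/
noncomputable def coeffHom (G : Type) {X : Type} [Group G] [MulAction G X] (x : X) :
    PermModule G X →+ ℤ :=
  (Finsupp.applyAddHom x).comp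
    ((MonoidAlgebra.coeffLinearEquiv ℤ).toLinearMap.toAddMonoidHom.comp
      (Representation.ofMulAction ℤ G X).asModuleEquiv.toLinearMap.toAddMonoidHom)

open Classical in
theorem coeffHom_basisVector (x y : X) :
    coeffHom G x (basisVector G y) = if y = x then 1 else 0 := by
  simp [coeffHom, basisVector, Finsupp.single_apply]

theorem permModule_ext {v w : PermModule G X} (h : ∀ x, coeffHom G x v = coeffHom G x w) :
    v = w := by
  apply (Representation.ofMulAction ℤ G X).asModuleEquiv.injective
  apply (MonoidAlgebra.coeffLinearEquiv ℤ).injective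
  exact Finsupp.ext h

instance : IsAddTorsionFree (PermModule G X) where
  nsmul_right_injective n hn v w h := by
    refine permModule_ext fun x => nsmul_right_injective hn ?_
    simpa only [map_nsmul] using congrArg (coeffHom G x) h

end PermModule

/-! ### Polytabloids as Specht vectors -/

section Specht

variable {lam : YoungDiagram}

attribute [local instance] groupAction

theorem smul_basisVector {α X : Type} [MulAction (Equiv.Perm α) X] (σ : Equiv.Perm α) (x : X) :
    σ • basisVector (Equiv.Perm α) x = basisVector (Equiv.Perm α) (σ • x) :=
  of_smul_basisVector σ x

theorem signedColumnSum_smul {V : Type*} [AddCommGroup V] [Module ℤ[SymbolPerm lam] V]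
    (t : Tableau lam) (v : V) : signedColumnSum t • v = colSum (colOf t) v := by
  rw [signedColumnSum, Finset.sum_smul, colSum]
  refine Finset.sum_congr (Finset.ext fun σ => by simp only [Finset.mem_filter]; rfl) fun σ _ => ?_
  rw [smul_assoc]
  rfl

/-- The coefficient of `x` is 1, since only the identity of the column group contributes to it. -/
theorem colSum_basisVector_ne_zero {α X : Type} [Fintype α] [DecidableEq α]
    [MulAction (Equiv.Perm α) X] {col : α → ℕ} {x : X}
    (h : ∀ τ : Equiv.Perm α, (∀ a, col (τ a) = col a) → τ • x = x → τ = 1) :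
    colSum col (basisVector (Equiv.Perm α) x) ≠ 0 := by
  intro h0
  have h1 := congrArg (coeffHom (Equiv.Perm α) x) h0
  rw [colSum, map_sum, map_zero, Finset.sum_eq_single_of_mem 1 (by simp)] at h1
  · simp [coeffHom_basisVector] at h1
  · intro τ hτ hne
    have hτ : ∀ a, col (τ a) = col a := by simpa using hτ
    rw [smul_basisVector, map_zsmul, coeffHom_basisVector, if_neg fun h' => hne (h τ hτ h'),
      smul_zero]

theorem isYoungShape_tableau (t : Tableau lam) : IsYoungShape (rowOf t) (colOf t) where
  inj a b hc hr := t.symm.injective (Subtype.ext (Prod.ext hr hc))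
  up b p hp := by
    have h : (p, colOf t b) ∈ lam :=
      lam.isLowerSet (show (p, colOf t b) ≤ (t.symm b).1 from ⟨hp.le, le_rfl⟩) (t.symm b).2
    exact ⟨t ⟨_, h⟩, by simp [colOf], by simp [rowOf]⟩
  left b i hi := by
    have h : (rowOf t b, i) ∈ lam :=
      lam.isLowerSet (show (rowOf t b, i) ≤ (t.symm b).1 from ⟨le_rfl, hi.le⟩) (t.symm b).2
    exact ⟨t ⟨_, h⟩, by simp [rowOf], by simp [colOf]⟩

theorem smul_tabloid_eq_iff (t : Tableau lam) (σ : SymbolPerm lam) :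
    σ • t.tabloid = t.tabloid ↔ ∀ a, rowOf t (σ⁻¹ a) = rowOf t a :=
  Quotient.eq (r := rowSetoid lam)

/-- The box of column `i` in the row of `b` serves as partner: exchanging the two does not change
the tabloid, so no compensation is needed. -/
theorem isSpechtVector_polytabloid (t : Tableau lam) :
    IsSpechtVector (colOf t) (polytabloid t) := by
  rw [polytabloid, signedColumnSum_smul]
  refine isSpechtVector_colSum fun b i hi => ?_
  obtain ⟨a, hr, hc⟩ := (isYoungShape_tableau t).left b i hi
  refine ⟨a, hc, 1, fun _ => rfl, map_one _, rfl, rfl, ?_⟩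
  rw [one_smul, smul_basisVector]
  congr 1
  rw [smul_tabloid_eq_iff]
  intro c
  rw [Equiv.swap_inv]
  by_cases h1 : c = a
  · subst h1; simp [hr]
  · by_cases h2 : c = b
    · subst h2; simp [hr]
    · rw [Equiv.swap_apply_of_ne_of_ne h1 h2]

theorem polytabloid_ne_zero (t : Tableau lam) : polytabloid t ≠ 0 := by
  rw [polytabloid, signedColumnSum_smul]
  refine colSum_basisVector_ne_zero fun τ hc hr => ?_
  rw [smul_tabloid_eq_iff] at hr
  refine Equiv.ext fun a => (isYoungShape_tableau t).inj _ _ (hc a) ?_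
  rw [← hr (τ a)]
  simp

end Specht

/-! ### Closed families and compensating permutations -/

section SetFamily

theorem majorizes_insert_erase {X : Finset ℕ+} {i l : ℕ+} (hl : l ∈ X) (hi : i ∉ X) (hil : i < l) :
    Majorizes (insert i (X.erase l)) X := by
  have hcard : (insert i (X.erase l)).card = X.card := by
    rw [Finset.card_insert_of_notMem fun h => hi (Finset.mem_of_mem_erase h),
      Finset.card_erase_add_one hl]
  refine List.forall₂_iff_get.2 ⟨by simpa using hcard, fun k hk hk' => ?_⟩
  set X' := insert i (X.erase l) with hX'
  rw [Finset.length_sort] at hk'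
  have hA : (X'.sort (· ≤ ·)).get ⟨k, hk⟩ = X'.orderEmbOfFin hcard ⟨k, hk'⟩ := by
    simp [Finset.orderEmbOfFin_apply]
  have hB : (X.sort (· ≤ ·)).get ⟨k, by simpa using hk'⟩ = X.orderEmbOfFin rfl ⟨k, hk'⟩ := by
    simp [Finset.orderEmbOfFin_apply]
  rw [hA, hB]
  by_contra! hlt
  set c := X.orderEmbOfFin rfl ⟨k, hk'⟩ with hc
  -- With positions counted from 0, `X` has at least `k + 1` elements up to `c`. Replacing `l` by
  -- the smaller `i` cannot reduce this number, but `X'` would have at most `k`.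
  have h1 : k + 1 ≤ (X.filter (· ≤ c)).card := by
    rw [← Fin.card_Iic (⟨k, hk'⟩ : Fin X.card), ← Finset.card_map
      (X.orderEmbOfFin rfl).toEmbedding]
    refine Finset.card_le_card fun y hy => ?_
    obtain ⟨j, hj, rfl⟩ := Finset.mem_map.1 hy
    exact Finset.mem_filter.2 ⟨Finset.orderEmbOfFin_mem X rfl j,
      (X.orderEmbOfFin rfl).monotone (Finset.mem_Iic.1 hj)⟩
  have h2 : (X.filter (· ≤ c)).card ≤ (X'.filter (· ≤ c)).card := by
    refine Finset.card_le_card_of_injOn (fun x => if x = l then i else x) ?_ ?_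
    · intro x hx
      have hx := Finset.mem_filter.1 (Finset.mem_coe.1 hx)
      refine Finset.mem_coe.2 (Finset.mem_filter.2 ?_)
      by_cases h : x = l
      · subst h
        simpa [hX'] using hil.le.trans hx.2
      · simpa [hX', h] using ⟨Or.inr hx.1, hx.2⟩
    · intro x hx y hy hxy
      have hx := (Finset.mem_filter.1 (Finset.mem_coe.1 hx)).1
      have hy := (Finset.mem_filter.1 (Finset.mem_coe.1 hy)).1
      by_cases h : x = l <;> by_cases h' : y = l
      · rw [h, h']
      · simp only [h, h', if_true, if_false] at hxy
        exact absurd (hxy ▸ hy) hi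
      · simp only [h, h', if_true, if_false] at hxy
        exact absurd (hxy ▸ hx) hi
      · simpa only [h, h', if_false] using hxy
  have h3 : (X'.filter (· ≤ c)).card ≤ k := by
    refine le_trans ?_ (Fin.card_Iio (⟨k, hk'⟩ : Fin X.card)).le
    rw [← Finset.card_map (X'.orderEmbOfFin hcard).toEmbedding]
    refine Finset.card_le_card fun y hy => ?_
    obtain ⟨hy, hyc⟩ := Finset.mem_filter.1 hy
    have hy' : y ∈ Set.range (X'.orderEmbOfFin hcard) := by
      rwa [Finset.range_orderEmbOfFin]
    obtain ⟨j, rfl⟩ := hy'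
    refine Finset.mem_map.2 ⟨j, Finset.mem_Iio.2 ?_, rfl⟩
    exact (X'.orderEmbOfFin hcard).lt_iff_lt.1 (hyc.trans_lt hlt)
  omega

/-- The involution exchanging `f x` with `g x` for all `x ∈ S`. -/
theorem exists_perm_exchange {ι α : Type*} [DecidableEq ι] [Fintype α] [DecidableEq α]
    (S : Finset ι) (f g : ι → α)
    (hf : Set.InjOn f S) (hg : Set.InjOn g S) (hfg : ∀ x ∈ S, ∀ y ∈ S, f x ≠ g y) :
    ∃ π : Equiv.Perm α, Equiv.Perm.sign π = (-1) ^ S.card ∧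
      (∀ x ∈ S, π (f x) = g x ∧ π (g x) = f x) ∧
      ∀ y, (∀ x ∈ S, y ≠ f x ∧ y ≠ g x) → π y = y := by
  induction S using Finset.induction_on with
  | empty => exact ⟨1, by simp, by simp, fun _ _ => rfl⟩
  | insert a S ha ih =>
    obtain ⟨π, h1, h2, h3⟩ := ih
      (hf.mono (by simp)) (hg.mono (by simp))
      fun x hx y hy => hfg x (Finset.mem_insert_of_mem hx) y (Finset.mem_insert_of_mem hy)
    have hne : f a ≠ g a := hfg a (by simp) a (by simp)
    have hxa : ∀ x ∈ S, f a ≠ f x ∧ f a ≠ g x ∧ g a ≠ f x ∧ g a ≠ g x := by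
      intro x hx
      have hne' : a ≠ x := by rintro rfl; exact ha hx
      have hx' := Finset.mem_insert_of_mem (a := x) (b := a) hx
      have ha' := Finset.mem_insert_self a S
      exact ⟨fun h => hne' (hf ha' hx' h), hfg a ha' x hx', (hfg x hx' a ha').symm,
        fun h => hne' (hg ha' hx' h)⟩
    refine ⟨Equiv.swap (f a) (g a) * π, ?_, ?_, ?_⟩
    · rw [map_mul, h1, Equiv.Perm.sign_swap hne, Finset.card_insert_of_notMem ha, pow_succ']
    · intro x hx
      rcases Finset.mem_insert.1 hx with rfl | hx
      · rw [Equiv.Perm.mul_apply, Equiv.Perm.mul_apply,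
          h3 (f x) fun y hy => ⟨(hxa y hy).1, (hxa y hy).2.1⟩,
          h3 (g x) fun y hy => ⟨(hxa y hy).2.2.1, (hxa y hy).2.2.2⟩]
        simp
      · obtain ⟨e1, e2, e3, e4⟩ := hxa x hx
        rw [Equiv.Perm.mul_apply, Equiv.Perm.mul_apply, (h2 x hx).1, (h2 x hx).2,
          Equiv.swap_apply_of_ne_of_ne e2.symm e4.symm,
          Equiv.swap_apply_of_ne_of_ne e1.symm e3.symm]
        exact ⟨rfl, rfl⟩
    · intro y hy
      rw [Equiv.Perm.mul_apply, h3 y fun x hx => hy x (Finset.mem_insert_of_mem hx)]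
      exact Equiv.swap_apply_of_ne_of_ne (hy a (by simp)).1 (hy a (by simp)).2

variable {m n : ℕ} {P : Finset (Finset ℕ+)} {lam : YoungDiagram}

theorem number_mem_of_mem_indexedBlock {X : Finset ℕ+} {s : Symbol lam}
    (hs : s ∈ indexedBlock lam P X) : s.number ∈ X :=
  (Finset.mem_filter.1 hs).2.1

theorem eq_of_number_eq {X : Finset ℕ+} {s s' : Symbol lam} (hs : s ∈ indexedBlock lam P X)
    (hs' : s' ∈ indexedBlock lam P X) (h : s.number = s'.number) : s = s' := by
  have h1 := (Finset.mem_filter.1 hs).2.2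
  have h2 := (Finset.mem_filter.1 hs').2.2
  rw [← h] at h2
  exact Subtype.ext (Prod.ext h (PNat.eq (h1.trans h2.symm)))

theorem exists_mem_indexedBlock (ht : HasType P lam) (s : Symbol lam) :
    ∃ X ∈ P, s ∈ indexedBlock lam P X := by
  have h : (s.index : ℕ) ∈ Finset.Icc 1 (conjPart lam s.number) :=
    Finset.mem_Icc.2 ⟨s.index.pos, s.2⟩
  rw [← image_indexOf ht] at h
  obtain ⟨X, hX, h⟩ := Finset.mem_image.1 h
  rw [Finset.mem_filter] at hX
  exact ⟨X, hX.1, Finset.mem_filter.2 ⟨Finset.mem_univ _, hX.2, h.symm⟩⟩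

theorem colOf_eq_iff {s s' : Symbol lam} :
    colOf (canonicalTableau lam) s = colOf (canonicalTableau lam) s' ↔ s.number = s'.number :=
  ⟨fun h => PNat.natPred_injective h, fun h => congrArg PNat.natPred h⟩

theorem smul_associatedPartition_eq (hm : 0 < m) (hP : IsSetFamily m n P) (ht : HasType P lam)
    {σ : SymbolPerm lam}
    (h : ∀ X ∈ P, ∃ Y ∈ P, ∀ s ∈ indexedBlock lam P X, σ s ∈ indexedBlock lam P Y) :
    σ • associatedPartition hm hP ht = associatedPartition hm hP ht := by
  refine Subtype.ext (Finpartition.ext ?_)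
  change σ • P.image (indexedBlock lam P) = P.image (indexedBlock lam P)
  refine Finset.eq_of_subset_of_card_le ?_ (Finset.card_smul_finset σ _).ge
  intro B hB
  obtain ⟨C, hC, rfl⟩ := Finset.mem_smul_finset.1 hB
  obtain ⟨X, hX, rfl⟩ := Finset.mem_image.1 hC
  obtain ⟨Y, hY, hXY⟩ := h X hX
  refine Finset.mem_image.2 ⟨Y, hY, Eq.symm (Finset.eq_of_subset_of_card_le ?_ ?_)⟩
  · intro s hs
    obtain ⟨s', hs', rfl⟩ := Finset.mem_smul_finset.1 hs
    exact hXY s' hs'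
  · rw [Finset.card_smul_finset, card_indexedBlock ht hX, card_indexedBlock ht hY,
      hP.card_mem X hX, hP.card_mem Y hY]

/-- A column permutation fixing the indexed set partition of a set family is trivial, because the
sets of the family are distinct. -/
theorem eq_one_of_smul_associatedPartition (hm : 0 < m) (hP : IsSetFamily m n P)
    (ht : HasType P lam) {τ : SymbolPerm lam}
    (hτ : ∀ s, colOf (canonicalTableau lam) (τ s) = colOf (canonicalTableau lam) s)
    (h : τ • associatedPartition hm hP ht = associatedPartition hm hP ht) : τ = 1 := by
  refine Equiv.ext fun s => ?_
  obtain ⟨X, hX, hs⟩ := exists_mem_indexedBlock ht s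
  have h1 : τ • P.image (indexedBlock lam P) = P.image (indexedBlock lam P) :=
    congrArg (fun u : UniformPartition (Symbol lam) m n => u.1.parts) h
  have h2 : τ • indexedBlock lam P X ∈ P.image (indexedBlock lam P) := by
    rw [← h1]
    exact Finset.smul_mem_smul_finset (Finset.mem_image_of_mem _ hX)
  obtain ⟨Y, hY, hYX⟩ := Finset.mem_image.1 h2
  have hmem : ∀ s' ∈ indexedBlock lam P X, τ s' ∈ indexedBlock lam P Y := by
    intro s' hs'
    rw [hYX]
    exact Finset.smul_mem_smul_finset (a := τ) hs'
  have hXY : X = Y := by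
    refine Finset.eq_of_subset_of_card_le (fun x hx => ?_)
      (by rw [hP.card_mem X hX, hP.card_mem Y hY])
    obtain ⟨s', hs', rfl⟩ := exists_symbol ht hX hx
    rw [← colOf_eq_iff.1 (hτ s')]
    exact number_mem_of_mem_indexedBlock (hmem s' hs')
  subst hXY
  exact eq_of_number_eq (hmem s hs) hs (colOf_eq_iff.1 (hτ s))

/-- Closedness of the family and oddness of `m` give the one-box Garnir relations. -/
theorem exists_compensating_perm (hm : Odd m) (hP : IsSetFamily m n P) (hclosed : IsClosedFamily P)
    (ht : HasType P lam) (b : Symbol lam) (i : ℕ) (hi : i < colOf (canonicalTableau lam) b) :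
    ∃ a, colOf (canonicalTableau lam) a = i ∧ ∃ π : SymbolPerm lam,
      (∀ c, colOf (canonicalTableau lam) (π c) = colOf (canonicalTableau lam) c) ∧
      Equiv.Perm.sign π = 1 ∧ π a = a ∧ π b = b ∧
      π • Equiv.swap a b • associatedPartition hm.pos hP ht
        = associatedPartition hm.pos hP ht := by
  obtain ⟨X, hX, hb⟩ := exists_mem_indexedBlock ht b
  have hbX := number_mem_of_mem_indexedBlock hb
  obtain ⟨j, rfl⟩ : ∃ j : ℕ+, PNat.natPred j = i := ⟨Nat.succPNat i, by simp⟩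
  have hj : j < b.number := PNat.natPred_lt_natPred.1 hi
  -- If `j ∈ X`, its symbol lies in the same block as `b`, and the exchange already fixes the set
  -- partition.
  by_cases hjX : j ∈ X
  · obtain ⟨a, ha, rfl⟩ := exists_symbol ht hX hjX
    refine ⟨a, rfl, 1, fun _ => rfl, map_one _, rfl, rfl, ?_⟩
    rw [one_smul]
    refine smul_associatedPartition_eq hm.pos hP ht fun Y hY => ⟨Y, hY, fun s hs => ?_⟩
    by_cases h1 : s = a
    · subst h1
      rw [eq_of_mem_indexedBlock hY hX hs ha]
      simpa using hb
    · by_cases h2 : s = b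
      · subst h2
        rw [eq_of_mem_indexedBlock hY hX hs hb]
        simpa using ha
      · rwa [Equiv.swap_apply_of_ne_of_ne h1 h2]
  · set X' := insert j (X.erase b.number) with hX'def
    have hbX' : b.number ∉ X' := by
      simp [hX'def, hj.ne']
    have hne : X' ≠ X := fun h => hbX' (h ▸ hbX)
    have hX' : X' ∈ P := hclosed X hX X' (majorizes_insert_erase hbX hjX hj) hne
    obtain ⟨a, ha, haj⟩ := exists_symbol ht hX' (Finset.mem_insert_self j _)
    have hf : ∀ x, ∃ s, x ∈ X → s ∈ indexedBlock lam P X ∧ s.number = x := by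
      intro x
      by_cases hx : x ∈ X
      · obtain ⟨s, hs⟩ := exists_symbol ht hX hx
        exact ⟨s, fun _ => hs⟩
      · exact ⟨b, fun h => absurd h hx⟩
    have hg : ∀ x, ∃ s, x ∈ X' → s ∈ indexedBlock lam P X' ∧ s.number = x := by
      intro x
      by_cases hx : x ∈ X'
      · obtain ⟨s, hs⟩ := exists_symbol ht hX' hx
        exact ⟨s, fun _ => hs⟩
      · exact ⟨b, fun h => absurd h hx⟩
    choose f hf using hf
    choose g hg using hg
    have hSX : ∀ x ∈ X.erase b.number, x ∈ X ∧ x ∈ X' :=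
      fun x hx => ⟨Finset.mem_of_mem_erase hx, Finset.mem_insert_of_mem hx⟩
    obtain ⟨π, h1, h2, h3⟩ := exists_perm_exchange (X.erase b.number) f g
      (fun x hx y hy h => by
        rw [← (hf x (hSX x hx).1).2, h, (hf y (hSX y hy).1).2])
      (fun x hx y hy h => by
        rw [← (hg x (hSX x hx).2).2, h, (hg y (hSX y hy).2).2])
      (fun x hx y hy h => by
        refine hne (eq_of_mem_indexedBlock hX' hX (s := f x) ?_ (hf x (hSX x hx).1).1)
        rw [h]
        exact (hg y (hSX y hy).2).1)
    have hpib : π b = b := by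
      refine h3 b fun x hx => ⟨?_, ?_⟩ <;> intro h
      · exact (Finset.mem_erase.1 hx).1 (by rw [h, (hf x (hSX x hx).1).2])
      · exact (Finset.mem_erase.1 hx).1 (by rw [h, (hg x (hSX x hx).2).2])
    have hpia : π a = a := by
      refine h3 a fun x hx => ⟨?_, ?_⟩ <;> intro h
      · exact hjX (by rw [← haj, h, (hf x (hSX x hx).1).2]; exact (hSX x hx).1)
      · exact hjX (by rw [← haj, h, (hg x (hSX x hx).2).2]; exact (hSX x hx).1)
    refine ⟨a, by rw [← haj]; rfl, π, ?_, ?_, hpia, hpib, ?_⟩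
    · intro c
      rw [colOf_eq_iff]
      by_cases hc : ∃ x ∈ X.erase b.number, c = f x ∨ c = g x
      · obtain ⟨x, hx, rfl | rfl⟩ := hc
        · rw [(h2 x hx).1, (hf x (hSX x hx).1).2, (hg x (hSX x hx).2).2]
        · rw [(h2 x hx).2, (hf x (hSX x hx).1).2, (hg x (hSX x hx).2).2]
      · push Not at hc
        rw [h3 c hc]
    · rw [h1, Finset.card_erase_of_mem hbX, hP.card_mem X hX]
      exact (Nat.Odd.sub_odd hm odd_one).neg_one_pow
    · rw [smul_smul]
      -- The product interchanges the blocks of `X` and `X'` and fixes every other block pointwise.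
      refine smul_associatedPartition_eq hm.pos hP ht fun Y hY => ?_
      by_cases hYX : Y = X
      · subst hYX
        refine ⟨X', hX', fun s hs => ?_⟩
        by_cases hsb : s = b
        · subst hsb
          simpa [hpia] using ha
        · have hsa : s ≠ a := by
            rintro rfl
            exact hne (eq_of_mem_indexedBlock hX' hX ha hs)
          have hsY := number_mem_of_mem_indexedBlock hs
          have hsn : s.number ∈ Y.erase b.number :=
            Finset.mem_erase.2 ⟨fun h => hsb (eq_of_number_eq hs hb h), hsY⟩
          have hsf : s = f s.number := eq_of_number_eq hs (hf _ hsY).1 (hf _ hsY).2.symm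
          rw [Equiv.Perm.mul_apply, Equiv.swap_apply_of_ne_of_ne hsa hsb, hsf, (h2 _ hsn).1]
          exact (hg _ (hSX _ hsn).2).1
      · by_cases hYX' : Y = X'
        · refine ⟨X, hX, fun s hs => ?_⟩
          rw [hYX'] at hs
          by_cases hsa : s = a
          · subst hsa
            simpa [hpib] using hb
          · have hsb : s ≠ b := by
              rintro rfl
              exact hne (eq_of_mem_indexedBlock hX' hX hs hb)
            have hsY := number_mem_of_mem_indexedBlock hs
            have hsn : s.number ∈ X.erase b.number :=
              (Finset.mem_insert.1 hsY).resolve_left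
                fun h => hsa (eq_of_number_eq hs ha (h.trans haj.symm))
            have hsf : s = g s.number := eq_of_number_eq hs (hg _ hsY).1 (hg _ hsY).2.symm
            rw [Equiv.Perm.mul_apply, Equiv.swap_apply_of_ne_of_ne hsa hsb, hsf, (h2 _ hsn).2]
            exact (hf _ (hSX _ hsn).1).1
        · refine ⟨Y, hY, fun s hs => ?_⟩
          have hsX : s ∉ indexedBlock lam P X := fun h => hYX (eq_of_mem_indexedBlock hY hX hs h)
          have hsX' : s ∉ indexedBlock lam P X' :=
            fun h => hYX' (eq_of_mem_indexedBlock hY hX' hs h)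
          have hsa : s ≠ a := by rintro rfl; exact hsX' ha
          have hsb : s ≠ b := by rintro rfl; exact hsX hb
          rw [Equiv.Perm.mul_apply, Equiv.swap_apply_of_ne_of_ne hsa hsb, h3 s]
          · exact hs
          · refine fun x hx => ⟨?_, ?_⟩ <;> rintro rfl
            · exact hsX (hf x (hSX x hx).1).1
            · exact hsX' (hg x (hSX x hx).2).1

end SetFamily

/-! ### Comparison of annihilators and the homomorphism -/

section Homomorphism

/-- Homomorphisms out of a cyclic module. -/
theorem exists_hom_of_smul_eq_zero_iff {R S W : Type*} [Ring R] [AddCommGroup S] [Module R S]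
    [AddCommGroup W] [Module R W] {e : S} {w : W} (he : ∀ v, ∃ x : R, x • e = v)
    (h : ∀ x : R, x • e = 0 ↔ x • w = 0) :
    ∃ f : S →ₗ[R] W, f e = w ∧ (∀ g : S →ₗ[R] W, g e = w → g = f) ∧ Function.Injective f := by
  let A := LinearMap.toSpanSingleton R S e
  let B := LinearMap.toSpanSingleton R W w
  have hA : Function.Surjective A := he
  have hAB : A.ker ≤ B.ker := fun x hx => (h x).1 hx
  let f : S →ₗ[R] W :=
    (A.ker.liftQ B hAB).comp (A.quotKerEquivOfSurjective hA).symm.toLinearMap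
  have hf : ∀ x : R, f (x • e) = x • w := by
    intro x
    have h1 : (A.quotKerEquivOfSurjective hA).symm (A x) = A.ker.mkQ x := by
      rw [LinearEquiv.symm_apply_eq]
      rfl
    change A.ker.liftQ B hAB ((A.quotKerEquivOfSurjective hA).symm (A x)) = _
    rw [h1]
    rfl
  have hf1 : f e = w := by
    simpa using hf 1
  refine ⟨f, hf1, fun g hg => ?_, (injective_iff_map_eq_zero f).2 fun v hv => ?_⟩
  · refine LinearMap.ext fun v => ?_
    obtain ⟨x, rfl⟩ := he v
    rw [map_smul, map_smul, hg, hf1]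
  · obtain ⟨x, rfl⟩ := he v
    rw [hf] at hv
    exact (h x).2 hv

attribute [local instance] groupAction

theorem IsSpechtVector.prod {α V W : Type*} [Fintype α] [DecidableEq α] [AddCommGroup V]
    [AddCommGroup W] [Module ℤ[Equiv.Perm α] V] [Module ℤ[Equiv.Perm α] W] {col : α → ℕ} {v : V}
    {w : W} (hv : IsSpechtVector col v) (hw : IsSpechtVector col w) :
    @IsSpechtVector α (V × W) _ _ _ (groupAction α (V × W)) col (v, w) where
  sign_smul τ hτ := Prod.ext (hv.sign_smul τ hτ) (hw.sign_smul τ hτ)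
  garnir b i hi := by
    refine Prod.ext ?_ ?_
    · rw [Prod.fst_sum]
      exact hv.garnir b i hi
    · rw [Prod.snd_sum]
      exact hw.garnir b i hi

/-- The pair `(v, w)` is itself a Specht vector, and each projection is injective on the module it
generates; an element killing one coordinate therefore kills the other. -/
theorem IsSpechtVector.smul_eq_zero_iff {α V W : Type*} [Fintype α] [DecidableEq α]
    [AddCommGroup V] [AddCommGroup W] [Module ℤ[Equiv.Perm α] V] [Module ℤ[Equiv.Perm α] W]
    [IsAddTorsionFree V] [IsAddTorsionFree W] {row col : α → ℕ} (hS : IsYoungShape row col)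
    {v : V} {w : W} (hv : IsSpechtVector col v) (hw : IsSpechtVector col w) (hv0 : v ≠ 0)
    (hw0 : w ≠ 0) (x : ℤ[Equiv.Perm α]) : x • v = 0 ↔ x • w = 0 := by
  constructor
  · intro h
    exact congrArg Prod.snd ((hv.prod hw).smul_eq_zero_of_map hS (LinearMap.fst _ V W) hv hv0 h)
  · intro h
    exact congrArg Prod.fst ((hv.prod hw).smul_eq_zero_of_map hS (LinearMap.snd _ V W) hw hw0 h)

theorem colSum_comp_inv {α V : Type*} [Fintype α] [DecidableEq α] [AddCommGroup V]
    [DistribMulAction (Equiv.Perm α) V] (col : α → ℕ) (σ : Equiv.Perm α) (v : V) :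
    colSum (col ∘ σ.symm) (σ • v) = σ • colSum col v := by
  unfold colSum
  rw [Finset.smul_sum]
  symm
  refine Finset.sum_equiv (MulAut.conj σ).toEquiv (fun τ => ?_) fun τ _ => ?_
  · simp only [Finset.mem_filter, Finset.mem_univ, true_and]
    constructor
    · intro h a
      simpa using h (σ.symm a)
    · intro h a
      simpa using h (σ a)
  · rw [smul_comm]
    have h : (Equiv.Perm.sign (σ * τ * σ⁻¹) : ℤ) = Equiv.Perm.sign τ := by
      rw [map_mul, map_mul, Equiv.Perm.sign_inv, mul_right_comm, Int.units_mul_self, one_mul]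
    change _ = (Equiv.Perm.sign (σ * τ * σ⁻¹) : ℤ) • (σ * τ * σ⁻¹) • σ • v
    rw [h, smul_smul, smul_smul, inv_mul_cancel_right]

variable {lam : YoungDiagram}

theorem polytabloid_smul (σ : SymbolPerm lam) (t : Tableau lam) :
    polytabloid (σ • t) = MonoidAlgebra.of ℤ (SymbolPerm lam) σ • polytabloid t := by
  rw [polytabloid, polytabloid, signedColumnSum_smul, signedColumnSum_smul]
  change _ = σ • colSum (colOf t) (basisVector (SymbolPerm lam) t.tabloid)
  rw [← colSum_comp_inv, smul_basisVector]
  rfl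

/-- Any two tableaux differ by a permutation of the symbols, so a single polytabloid generates. -/
theorem mem_spechtModule_iff (t : Tableau lam) (v : YoungModule lam) :
    v ∈ SpechtModule lam ↔ ∃ x : ℤ[SymbolPerm lam], x • polytabloid t = v := by
  rw [← Submodule.mem_span_singleton]
  have hle : Submodule.span ℤ[SymbolPerm lam] {polytabloid t} ≤ SpechtModule lam :=
    Submodule.span_mono (Set.singleton_subset_iff.2 ⟨t, rfl⟩)
  refine ⟨fun h => ?_, fun h => hle h⟩
  refine (Submodule.span_le (p := Submodule.span ℤ[SymbolPerm lam] {polytabloid t})).2 ?_ h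
  rintro _ ⟨s, rfl⟩
  have hs : s = (t.symm.trans s : SymbolPerm lam) • t := by
    change s = t.trans (t.symm.trans s)
    simp [← Equiv.trans_assoc]
  rw [hs, polytabloid_smul]
  exact Submodule.smul_mem _ _ (Submodule.mem_span_singleton_self _)

theorem exists_smul_spechtPolytabloid (t : Tableau lam) (v : SpechtModule lam) :
    ∃ x : ℤ[SymbolPerm lam], x • spechtPolytabloid t = v := by
  obtain ⟨x, hx⟩ := (mem_spechtModule_iff t v.1).1 v.2
  exact ⟨x, Subtype.ext hx⟩

/-- A nonzero Specht vector `w` is the image of the polytabloid of `t` under a unique homomorphism,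
and this is injective. -/
theorem IsSpechtVector.exists_hom {W : Type*} [AddCommGroup W] [Module ℤ[SymbolPerm lam] W]
    [IsAddTorsionFree W] (t : Tableau lam) {w : W} (hw : IsSpechtVector (colOf t) w)
    (hw0 : w ≠ 0) :
    ∃ f : SpechtModule lam →ₗ[ℤ[SymbolPerm lam]] W, f (spechtPolytabloid t) = w ∧
      (∀ g : SpechtModule lam →ₗ[ℤ[SymbolPerm lam]] W, g (spechtPolytabloid t) = w → g = f) ∧
      Function.Injective f := by
  have hiff : ∀ x : ℤ[SymbolPerm lam], x • spechtPolytabloid t = 0 ↔ x • w = 0 := fun x =>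
    Subtype.ext_iff.trans ((isSpechtVector_polytabloid t).smul_eq_zero_iff
      (isYoungShape_tableau t) hw (polytabloid_ne_zero t) hw0 x)
  exact exists_hom_of_smul_eq_zero_iff (R := ℤ[SymbolPerm lam]) (S := SpechtModule lam)
    (exists_smul_spechtPolytabloid t) hiff

variable {m n : ℕ} {P : Finset (Finset ℕ+)}

theorem isSpechtVector_associatedPartition (hm : Odd m) (hP : IsSetFamily m n P)
    (hclosed : IsClosedFamily P) (ht : HasType P lam) :
    IsSpechtVector (colOf (canonicalTableau lam)) (signedColumnSum (canonicalTableau lam) •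
      basisVector (SymbolPerm lam) (associatedPartition hm.pos hP ht)) := by
  rw [signedColumnSum_smul]
  refine isSpechtVector_colSum fun b i hi => ?_
  obtain ⟨a, ha, π, h1, h2, h3, h4, h5⟩ := exists_compensating_perm hm hP hclosed ht b i hi
  refine ⟨a, ha, π, h1, h2, h3, h4, ?_⟩
  rw [smul_basisVector, smul_basisVector, h5]

theorem signedColumnSum_smul_associatedPartition_ne_zero (hm : 0 < m) (hP : IsSetFamily m n P)
    (ht : HasType P lam) :
    signedColumnSum (canonicalTableau lam) •
      basisVector (SymbolPerm lam) (associatedPartition hm hP ht) ≠ 0 := by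
  rw [signedColumnSum_smul]
  exact colSum_basisVector_ne_zero fun τ hτ h => eq_one_of_smul_associatedPartition hm hP ht hτ h

end Homomorphism

end Foulkes

theorem theorem1p1 (m n : ℕ) (hm : Odd m) (P : Finset (Finset ℕ+)) (lam : YoungDiagram)
    (hP : Foulkes.IsSetFamily m n P) (hclosed : Foulkes.IsClosedFamily P)
    (ht : Foulkes.HasType P lam) :
    ∃ f : Foulkes.SpechtModule lam →ₗ[ℤ[Foulkes.SymbolPerm lam]]
        Foulkes.FoulkesModule (Foulkes.Symbol lam) m n,
      f (Foulkes.spechtPolytabloid (Foulkes.canonicalTableau lam)) =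
          Foulkes.signedColumnSum (Foulkes.canonicalTableau lam) •
            Foulkes.basisVector (Foulkes.SymbolPerm lam)
              (Foulkes.associatedPartition hm.pos hP ht) ∧
        (∀ g : Foulkes.SpechtModule lam →ₗ[ℤ[Foulkes.SymbolPerm lam]]
            Foulkes.FoulkesModule (Foulkes.Symbol lam) m n,
          g (Foulkes.spechtPolytabloid (Foulkes.canonicalTableau lam)) =
              Foulkes.signedColumnSum (Foulkes.canonicalTableau lam) •
                Foulkes.basisVector (Foulkes.SymbolPerm lam)
                  (Foulkes.associatedPartition hm.pos hP ht) → g = f) ∧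
        Function.Injective f := by
  exact (Foulkes.isSpechtVector_associatedPartition hm hP hclosed ht).exists_hom _
    (Foulkes.signedColumnSum_smul_associatedPartition_ne_zero hm.pos hP ht)
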